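/- Let $T=\mathrm{diag}(1,e^{i\pi/4})$, $\sqrt T=\mathrm{diag}(1,e^{i\pi/8})$, $\sqrt T^3=(\sqrt T)^3$, and for $V\in\{T,\sqrt T,\sqrt T^3\}$ let $|V\rangle=V|+\rangle$ be the corresponding one-qubit resource state. Consider adaptive protocols that take one qubit as input, output one qubit, and consist of finitely many of the following steps, each of which may depend on the measurement outcomes (and classical coin tosses) obtained so far: stabilizer operations (Clifford unitaries, preparation of stabilizer ancilla states, measurements of multi-qubit Pauli observables, discarding qubits), classical coin tosses, and the consumption of a fresh copy of $|T\rangle$, $|\sqrt T\rangle$ or $|\sqrt T^3\rangle$. For each sequence of outcomes of the protocol, let $\mathcal N_T$ be the number of copies of $|T\rangle$ consumed, and $\mathcal N_{\sqrt T}$ the number of copies of $|\sqrt T\rangle$ and $|\sqrt T^3\rangle$ consumed, taken together; on a given input state these are random variables. The protocol approximates a one-qubit unitary $U$ to within precision $\varepsilon$ if its channel $\Phi$ (the output averaged over all outcomes) satisfies $\|\Phi-U(\cdot)U^\dagger\|_\diamond\le\varepsilon$, where $\|\Phi\|_\diamond=\sup_k\sup_{\|A\|_1\le 1}\|(\Phi\otimes\mathrm{id}_k)(A)\|_1$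 and $\|\cdot\|_1$ is the trace norm. A property is said to hold with probability at least $p$ if for every input state of the protocol the probability of the outcome sequences that have the property is at least $p$. **Theorem.** Let $C>1$ and $0<\varepsilon<1/(2^8C)$. Then there exists a one-qubit unitary $U$ such that every protocol as above that approximates $U$ to within precision $\varepsilon$ satisfies $$\mathcal N_{\sqrt T}+\frac67\,\mathcal N_T\;\ge\;\frac1{14}\log_2(1/\varepsilon)-\frac1{14}\log_2 C-\frac3{14}$$ with probability at least $(C-1)/C$. In particular, this is the case for every one-qubit unitary $U$ with $$2\sqrt{C\varepsilon}\le|\langle 0|U|1\rangle|^2\le 6\sqrt{C\varepsilon}.$$ -/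

import Mathlib

open scoped ComplexOrder ENNReal

noncomputable section

namespace StabSynth

/-- Operators on `n` qubits, in the computational basis (indexed by bit strings). -/
abbrev Op (n : ℕ) : Type := Matrix (Fin n → Fin 2) (Fin n → Fin 2) ℂ

/-- Operators on a single qubit. -/
abbrev Op₁ : Type := Matrix (Fin 2) (Fin 2) ℂ

/-! ### Pauli operators and Clifford unitaries -/

/-- Labels of the four single-qubit Pauli matrices. -/
inductive Pauli : Type
  | I
  | X
  | Y
  | Z

/-- The single-qubit Pauli matrices. -/
def Pauli.toMatrix : Pauli → Op₁
  | .I => !![1, 0; 0, 1]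
  | .X => !![0, 1; 1, 0]
  | .Y => !![0, -Complex.I; Complex.I, 0]
  | .Z => !![1, 0; 0, -1]

/-- The `n`-qubit Pauli matrix `P₁ ⊗ ⋯ ⊗ Pₙ`. -/
def pauliString {n : ℕ} (P : Fin n → Pauli) : Op n :=
  Matrix.of fun x y => ∏ i, (P i).toMatrix (x i) (y i)

/-- The `n`-qubit Pauli group: Pauli strings with a phase in `{1, i, -1, -i}`. -/
def pauliGroup (n : ℕ) : Set (Op n) :=
  {A | ∃ (k : Fin 4) (P : Fin n → Pauli), A = Complex.I ^ (k : ℕ) • pauliString P}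

/-- Clifford unitaries: the unitaries that map the Pauli group to itself by conjugation. -/
def IsClifford {n : ℕ} (U : Op n) : Prop :=
  U ∈ Matrix.unitaryGroup (Fin n → Fin 2) ℂ ∧
    ∀ A ∈ pauliGroup n, U * A * U.conjTranspose ∈ pauliGroup n

/-- The projector onto the `+1` (for `true`) or `-1` (for `false`) eigenspace of a Pauli string. -/
def pauliProj {n : ℕ} (P : Fin n → Pauli) : Bool → Op n
  | true => (1 / 2 : ℂ) • (1 + pauliString P)
  | false => (1 / 2 : ℂ) • (1 - pauliString P)

/-! ### One-qubit states that are prepared or consumed -/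

/-- The density matrix `|ψ⟩⟨ψ|` of a one-qubit vector. -/
def pureState (ψ : Fin 2 → ℂ) : Op₁ := Matrix.vecMulVec ψ (star ψ)

/-- The state `|0⟩`. -/
def ketZero : Fin 2 → ℂ := ![1, 0]

/-- The state `(|0⟩ + exp(iθ)|1⟩)/√2`. -/
def phaseKet (θ : ℝ) : Fin 2 → ℂ :=
  ![1 / (Real.sqrt 2 : ℂ), Complex.exp (θ * Complex.I) / (Real.sqrt 2 : ℂ)]

/-- The three kinds of resource states: `|T⟩`, `|√T⟩` and `|√T³⟩`. -/
inductive Resource : Type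
  | T
  | rootT
  | rootTCubed

/-- The resource states `T|+⟩`, `√T|+⟩`, `√T³|+⟩`, where `T = diag(1, exp(iπ/4))` and
`√T = diag(1, exp(iπ/8))`. -/
def Resource.ket : Resource → Fin 2 → ℂ
  | .T => phaseKet (Real.pi / 4)
  | .rootT => phaseKet (Real.pi / 8)
  | .rootTCubed => phaseKet (3 * Real.pi / 8)

/-! ### Elementary maps on operators -/

/-- Conjugation `ρ ↦ K ρ K†`. -/
def conjBy {n : ℕ} (K : Op n) : Op n →ₗ[ℂ] Op n where
  toFun ρ := K * ρ * K.conjTranspose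
  map_add' ρ σ := by rw [Matrix.mul_add, Matrix.add_mul]
  map_smul' c ρ := by simp

/-- Appending a fresh last qubit in the state `σ`: `ρ ↦ ρ ⊗ σ`. -/
def appendQubit {n : ℕ} (σ : Op₁) : Op n →ₗ[ℂ] Op (n + 1) where
  toFun ρ := Matrix.of fun x y =>
    ρ (fun i => x i.castSucc) (fun i => y i.castSucc) * σ (x (Fin.last n)) (y (Fin.last n))
  map_add' ρ τ := by ext x y; simp [add_mul]
  map_smul' c ρ := by ext x y; simp [mul_assoc]

/-- Keeping qubit `j` and tracing out all the others. -/
def keepQubit {n : ℕ} (j : Fin n) : Op n →ₗ[ℂ] Op₁ where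
  toFun ρ := Matrix.of fun a b =>
    ∑ x : Fin n → Fin 2, if x j = a then ρ x (Function.update x j b) else 0
  map_add' ρ σ := by
    ext a b
    simp only [Matrix.of_apply, Matrix.add_apply, ← Finset.sum_add_distrib]
    refine Finset.sum_congr rfl fun x _ => ?_
    split_ifs <;> simp
  map_smul' c ρ := by
    ext a b
    simp only [Matrix.of_apply, Matrix.smul_apply, Finset.smul_sum, RingHom.id_apply]
    refine Finset.sum_congr rfl fun x _ => ?_
    split_ifs <;> simp

/-- Regarding a one-qubit operator as an operator on a register of length one. -/
def singleRegister : Op₁ →ₗ[ℂ] Op 1 where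
  toFun ρ := Matrix.of fun x y => ρ (x 0) (y 0)
  map_add' _ _ := rfl
  map_smul' _ _ := rfl

/-! ### Adaptive protocols -/

/-- The part of an adaptive protocol that remains to be carried out when the register holds `n`
qubits. It is a finite tree of stabilizer operations and of requests for resource states; what is
done after a measurement or a classical coin toss may depend on the result. Every stabilizer
ancilla state is obtained from `|0⟩` ancillas by Clifford unitaries. A discarded qubit is one that
is not used any more: it is traced out at the end. -/
inductive Protocol : ℕ → Type
  /-- stop, output qubit `j` and discard the rest -/
  | output {n : ℕ} (j : Fin n) : Protocol n
  /-- apply a Clifford unitary -/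
  | clifford {n : ℕ} (U : Op n) (hU : IsClifford U) (next : Protocol n) : Protocol n
  /-- append an ancilla qubit in the state `|0⟩` -/
  | ancilla {n : ℕ} (next : Protocol (n + 1)) : Protocol n
  /-- consume a resource state: append it to the register -/
  | resource {n : ℕ} (r : Resource) (next : Protocol (n + 1)) : Protocol n
  /-- measure a Pauli observable and continue according to the outcome `+1` or `-1` -/
  | measure {n : ℕ} (P : Fin n → Pauli) (onPlus onMinus : Protocol n) : Protocol n
  /-- toss a classical coin that shows heads with probability `p` -/
  | coin {n : ℕ} (p : Set.Icc (0 : ℝ) 1) (onHeads onTails : Protocol n) : Protocol n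

/-- The post-selected circuit that belongs to one sequence of outcomes of a protocol: the numbers of
resource states it consumes, and the map from the register to the unnormalized output qubit, whose
trace is the probability of that sequence of outcomes. -/
structure Run (n : ℕ) where
  /-- number of copies of `|T⟩` consumed -/
  numT : ℕ
  /-- number of copies of `|√T⟩` and `|√T³⟩` consumed, taken together -/
  numRootT : ℕ
  /-- unnormalized output as a function of the state of the register -/
  map : Op n →ₗ[ℂ] Op₁

/-- Precede a run by an operation. -/
def Run.after {m n : ℕ} (F : Op m →ₗ[ℂ] Op n) (r : Run n) : Run m :=
  ⟨r.numT, r.numRootT, r.map ∘ₗ F⟩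

/-- Add a resource state to the count of a run. -/
def Run.count {n : ℕ} (s : Resource) (r : Run n) : Run n :=
  match s with
  | .T => { r with numT := r.numT + 1 }
  | .rootT => { r with numRootT := r.numRootT + 1 }
  | .rootTCubed => { r with numRootT := r.numRootT + 1 }

/-- All runs of a protocol, one for each sequence of outcomes. -/
def Protocol.runs : {n : ℕ} → Protocol n → List (Run n)
  | _, .output j => [⟨0, 0, keepQubit j⟩]
  | _, .clifford U _ next => next.runs.map (Run.after (conjBy U))
  | _, .ancilla next => next.runs.map (Run.after (appendQubit (pureState ketZero)))
  | _, .resource s next =>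
      next.runs.map fun r => Run.count s (r.after (appendQubit (pureState s.ket)))
  | _, .measure P onPlus onMinus =>
      onPlus.runs.map (Run.after (conjBy (pauliProj P true))) ++
        onMinus.runs.map (Run.after (conjBy (pauliProj P false)))
  | _, .coin p onHeads onTails =>
      onHeads.runs.map (Run.after (((p : ℝ) : ℂ) • LinearMap.id)) ++
        onTails.runs.map (Run.after (((1 - (p : ℝ) : ℝ) : ℂ) • LinearMap.id))

/-- The one-qubit channel implemented by a protocol whose register initially holds the input qubit:
its output averaged over all outcomes. -/
def Protocol.channel (π : Protocol 1) : Op₁ →ₗ[ℂ] Op₁ :=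
  (π.runs.map fun r => r.map ∘ₗ singleRegister).sum

/-- One-qubit density matrices. -/
def IsDensity (ρ : Op₁) : Prop := ρ.PosSemidef ∧ ρ.trace = 1

/-- The probability that the run of the protocol on the input state `ρ` has the property `Q`. -/
def Protocol.probability (π : Protocol 1) (Q : Run 1 → Prop) (ρ : Op₁) : ℝ :=
  open Classical in
  (π.runs.map fun r => if Q r then (r.map (singleRegister ρ)).trace.re else 0).sum

/-- The protocol has the property `Q` with probability at least `p`: this holds for every input
state. -/
def Protocol.HasWithProbability (π : Protocol 1) (Q : Run 1 → Prop) (p : ℝ) : Prop :=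
  ∀ ρ : Op₁, IsDensity ρ → p ≤ π.probability Q ρ

/-! ### The diamond norm -/

/-- The trace norm `‖A‖₁ = Tr √(A† A)`, the sum of the singular values. -/
def traceNorm {ι : Type} [Fintype ι] [DecidableEq ι] (A : Matrix ι ι ℂ) : ℝ :=
  ∑ i, Real.sqrt ((Matrix.isHermitian_conjTranspose_mul_self A).eigenvalues i)

/-- `Φ ⊗ id` on a qubit together with a `k`-dimensional system. -/
def tensorId (Φ : Op₁ →ₗ[ℂ] Op₁) (k : ℕ) (A : Matrix (Fin 2 × Fin k) (Fin 2 × Fin k) ℂ) :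
    Matrix (Fin 2 × Fin k) (Fin 2 × Fin k) ℂ :=
  Matrix.of fun x y => Φ (Matrix.of fun a b => A (a, x.2) (b, y.2)) x.1 y.1

/-- The diamond norm `‖Φ‖_⋄ = sup {‖(Φ ⊗ id_k)(A)‖₁ : k ∈ ℕ, ‖A‖₁ ≤ 1}`. -/
def diamondNorm (Φ : Op₁ →ₗ[ℂ] Op₁) : ℝ≥0∞ :=
  ⨆ (k : ℕ) (A : Matrix (Fin 2 × Fin k) (Fin 2 × Fin k) ℂ) (_ : traceNorm A ≤ 1),
    ENNReal.ofReal (traceNorm (tensorId Φ k A))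

/-- The channel `ρ ↦ U ρ U†` of a one-qubit unitary. -/
def unitaryChannel (U : Op₁) : Op₁ →ₗ[ℂ] Op₁ where
  toFun ρ := U * ρ * U.conjTranspose
  map_add' ρ σ := by rw [Matrix.mul_add, Matrix.add_mul]
  map_smul' c ρ := by simp

/-- The protocol approximates `U` to within precision `ε` in the diamond norm. -/
def Protocol.Approximates (π : Protocol 1) (U : Op₁) (ε : ℝ) : Prop :=
  diamondNorm (π.channel - unitaryChannel U) ≤ ENNReal.ofReal ε

/-- Every protocol that approximates `U` to within `ε` satisfies, with probability at least
`(C - 1) / C`, the lower bound on the numbers of resource states that it consumes. -/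
def ResourceLowerBound (C ε : ℝ) (U : Op₁) : Prop :=
  ∀ π : Protocol 1, π.Approximates U ε →
    π.HasWithProbability
      (fun r => (1 / 14) * Real.logb 2 (1 / ε) - (1 / 14) * Real.logb 2 C - 3 / 14
        ≤ (r.numRootT : ℝ) + (6 / 7) * (r.numT : ℝ))
      ((C - 1) / C)

end StabSynth

end

/-! Idea of the proof. Fix one sequence of outcomes and work in the Heisenberg picture. The
projectors onto the two output basis states, pulled back through the run, become operators `D 0`, `D
1` on the register and the consumed resource qubits. Stabilizer operations keep them `Flat`, that
is, proportional to stabilizer code projectors or zero, and `Matched`: if both are nonzero, their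
Pauli coefficients agree up to signs, so that their traces coincide (`Protocol.exists_represents`).
Hence, on a basis state as input, each output probability is the expectation of a flat operator in
the product state of the resources.

Such an expectation cannot be small without vanishing (`Flat.le_trace`). Divided by the trace and
multiplied by explicit factors, it is an integral polynomial in `2 cos (π / 8)`, a root of `X⁴ - 4X²
+ 2`, so the product over the four roots is a nonzero integer if the value itself is nonzero. The
Galois conjugates of resource states are again pure states, so the other three factors are at most
the trace. With `M` copies of `|T⟩` and `N` copies of the other states, `M + N ≥ 1`, two nonzero
output probabilities of one run therefore have ratio at least `4 / K`, where `K = 64 ^ M * 128 ^ N`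
(`Protocol.prob_ratio`). Without resources they are equal.

Let `s = |⟨0|U|1⟩|²`. On a basis state, `U` produces one of the two outcomes with the small
probability `s`, of order `√(Cε)`. A run that violates the bound has `8 K² C ε < 1`, and then its
two output probabilities cannot be in a ratio close to that of `s` and `1 - s`; at least the
fraction `2Cε` of its weight lies in the state orthogonal to the correct output
(`error_lower_bound`, `Run.error_of_not_satisfiesBound`). The total of these errors is at most `ε`,
so the violating runs have probability at most `1 / (2C)` on each basis state. Every density matrix
is bounded by the identity, the sum of the two basis projectors, so they have probability at most `1
/ C` on every input. -/

noncomputable section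

namespace StabSynth

open Matrix
open scoped Kronecker

set_option linter.unusedSectionVars false

/-! ### Flat and matched operators, and their stability under Pauli projections -/

section Flat

variable {ι κ : Type*} [Fintype ι] [DecidableEq ι] [Fintype κ] [DecidableEq κ]

/-- A set of Hermitian involutions that is closed under multiplication up to fourth roots of
unity. -/
structure IsPauliFamily (S : Set (Matrix ι ι ℂ)) : Prop where
  isHermitian : ∀ P ∈ S, P.IsHermitian
  mul_self : ∀ P ∈ S, P * P = 1
  mul_mem : ∀ P ∈ S, ∀ Q ∈ S, ∃ R ∈ S, ∃ c : ℂ, c ^ 4 = 1 ∧ P * Q = c • R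

/-- A positive semidefinite matrix is flat if all of its nonzero coefficients with respect to a
family of Pauli matrices agree up to sign with its trace. -/
structure Flat (S : Set (Matrix ι ι ℂ)) (D : Matrix ι ι ℂ) : Prop where
  posSemidef : D.PosSemidef
  trace_mul : ∀ P ∈ S, (P * D).trace = 0 ∨ (P * D).trace = D.trace ∨ (P * D).trace = -D.trace

/-- Two matrices are matched if their Pauli coefficients agree up to signs, unless one of the
matrices vanishes. -/
def Matched (S : Set (Matrix ι ι ℂ)) (D₀ D₁ : Matrix ι ι ℂ) : Prop :=
  D₀ = 0 ∨ D₁ = 0 ∨ ∀ P ∈ S, (P * D₀).trace = (P * D₁).trace ∨ (P * D₀).trace = -(P * D₁).trace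

lemma fourth_root_cases {c : ℂ} (hc : c ^ 4 = 1) :
    (c = 1 ∨ c = -1) ∨ (c = Complex.I ∨ c = -Complex.I) := by
  have h : (c - 1) * (c + 1) * ((c - Complex.I) * (c + Complex.I)) = 0 := by
    linear_combination hc - (c ^ 2 - 1) * Complex.I_sq
  rcases mul_eq_zero.1 h with h | h <;> rcases mul_eq_zero.1 h with h | h
  · exact .inl (.inl (sub_eq_zero.1 h))
  · exact .inl (.inr (eq_neg_of_add_eq_zero_left h))
  · exact .inr (.inl (sub_eq_zero.1 h))
  · exact .inr (.inr (eq_neg_of_add_eq_zero_left h))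

open scoped MatrixOrder Matrix.Norms.L2Operator in
lemma exists_eq_conjTranspose_mul_self {D : Matrix ι ι ℂ} (hD : D.PosSemidef) :
    ∃ B : Matrix ι ι ℂ, D = Bᴴ * B :=
  CStarAlgebra.nonneg_iff_eq_star_mul_self.mp hD.nonneg

/-- Write `D = Bᴴ B`. Since `(1 - P)² = 2 (1 - P)`, the Hilbert–Schmidt norm of `B (1 - P)` is
governed by `tr D - tr (P D) = 0`. Thus a Pauli coefficient of maximal size means that the Pauli
matrix stabilizes `D` up to sign. -/
lemma mul_eq_self_of_trace_eq {D P : Matrix ι ι ℂ} (hD : D.PosSemidef) (hP : P.IsHermitian)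
    (hPP : P * P = 1) (h : (P * D).trace = D.trace) : P * D = D := by
  obtain ⟨B, rfl⟩ := exists_eq_conjTranspose_mul_self hD
  have h1 : ((B * (1 - P))ᴴ * (B * (1 - P))).trace = 0 := by
    rw [conjTranspose_mul, conjTranspose_sub, conjTranspose_one, hP.eq,
      show (1 - P) * Bᴴ * (B * (1 - P)) = (1 - P) * (Bᴴ * B * (1 - P)) by
        simp only [Matrix.mul_assoc],
      trace_mul_comm, Matrix.mul_assoc, show (1 - P) * (1 - P) = (2 : ℂ) • (1 - P) by
        rw [sub_mul, mul_sub, mul_sub, hPP]; simp only [one_mul, mul_one]; rw [two_smul]; abel,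
      Matrix.mul_smul, trace_smul, Matrix.mul_sub, trace_sub, trace_mul_comm _ P, h]
    simp
  have h2 : B * (1 - P) = 0 := trace_conjTranspose_mul_self_eq_zero_iff.1 h1
  have h3 : (1 - P) * Bᴴ = 0 := by
    have := congrArg conjTranspose h2
    simpa [conjTranspose_mul, hP.eq] using this
  have h4 : (1 - P) * (Bᴴ * B) = 0 := by rw [← Matrix.mul_assoc, h3, Matrix.zero_mul]
  rw [Matrix.sub_mul, Matrix.one_mul, sub_eq_zero] at h4
  exact h4.symm

lemma mul_eq_neg_of_trace_eq {D P : Matrix ι ι ℂ} (hD : D.PosSemidef) (hP : P.IsHermitian)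
    (hPP : P * P = 1) (h : (P * D).trace = -D.trace) : P * D = -D := by
  have := mul_eq_self_of_trace_eq hD hP.neg (by simpa using hPP) (by simp [h])
  rw [Matrix.neg_mul] at this
  rw [← neg_eq_iff_eq_neg, this]

variable {S : Set (Matrix ι ι ℂ)}

lemma Flat.zero : Flat S 0 := ⟨.zero, fun P _ => .inl (by simp)⟩

lemma Flat.smul {D : Matrix ι ι ℂ} (hD : Flat S D) {p : ℝ} (hp : 0 ≤ p) :
    Flat S ((p : ℂ) • D) := by
  refine ⟨hD.posSemidef.smul (by exact_mod_cast hp), fun P hP => ?_⟩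
  rcases hD.trace_mul P hP with h | h | h <;> simp [h]

lemma Matched.smul {D₀ D₁ : Matrix ι ι ℂ} (h : Matched S D₀ D₁) (p : ℂ) :
    Matched S (p • D₀) (p • D₁) := by
  rcases h with h | h | h
  · exact .inl (by simp [h])
  · exact .inr (.inl (by simp [h]))
  · refine .inr (.inr fun P hP => ?_)
    rcases h P hP with h | h <;> simp [h]

/-- Flatness is inherited along any positive map whose dual maps Pauli matrices to Pauli matrices
up to sign. -/
lemma Flat.of_trace {T : Set (Matrix κ κ ℂ)} {D : Matrix ι ι ℂ} {D' : Matrix κ κ ℂ}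
    (hD : Flat S D) (hD' : D'.PosSemidef) (h1 : D'.trace = D.trace)
    (h : ∀ P ∈ T, ∃ P' ∈ S, (P * D').trace = (P' * D).trace ∨ (P * D').trace = -(P' * D).trace) :
    Flat T D' := by
  refine ⟨hD', fun P hP => ?_⟩
  obtain ⟨P', hP', h⟩ := h P hP
  rw [h1]
  rcases h with h | h <;> rcases hD.trace_mul P' hP' with h' | h' | h' <;> simp [h, h']

lemma Matched.of_trace {T : Set (Matrix κ κ ℂ)} {D₀ D₁ : Matrix ι ι ℂ} {D₀' D₁' : Matrix κ κ ℂ}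
    (hD : Matched S D₀ D₁) (h0 : D₀ = 0 → D₀' = 0) (h1 : D₁ = 0 → D₁' = 0)
    (h : ∀ P ∈ T, ∃ P' ∈ S, ∃ e : ℂ,
      (P * D₀').trace = e * (P' * D₀).trace ∧ (P * D₁').trace = e * (P' * D₁).trace) :
    Matched T D₀' D₁' := by
  rcases hD with hD | hD | hD
  · exact .inl (h0 hD)
  · exact .inr (.inl (h1 hD))
  · refine .inr (.inr fun P hP => ?_)
    obtain ⟨P', hP', e, h, h'⟩ := h P hP
    rw [h, h']
    rcases hD P' hP' with h | h <;> simp [h]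

/-- The projector onto the eigenspace of a Hermitian involution for the eigenvalue `s`. -/
def eigenProj (s : ℂ) (P : Matrix ι ι ℂ) : Matrix ι ι ℂ := (1 / 2 : ℂ) • (1 + s • P)

lemma eigenProj_isHermitian {s : ℂ} (hs : s = 1 ∨ s = -1) {P : Matrix ι ι ℂ}
    (hP : P.IsHermitian) : (eigenProj s P).IsHermitian := by
  rw [IsHermitian, eigenProj]
  rcases hs with rfl | rfl <;> simp [conjTranspose_smul, hP.eq]

lemma eigenProj_mul_of_eq {s : ℂ} (hs : s = 1 ∨ s = -1) {P D : Matrix ι ι ℂ} (h : P * D = s • D) :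
    eigenProj s P * D = D := by
  rw [eigenProj, Matrix.smul_mul, Matrix.add_mul, Matrix.smul_mul, h, smul_smul, Matrix.one_mul]
  rcases hs with rfl | rfl <;> simp [← two_smul ℂ D, smul_smul]

lemma eigenProj_mul_of_eq_neg {s : ℂ} (hs : s = 1 ∨ s = -1) {P D : Matrix ι ι ℂ}
    (h : P * D = -(s • D)) : eigenProj s P * D = 0 := by
  rw [eigenProj, Matrix.smul_mul, Matrix.add_mul, Matrix.smul_mul, h, smul_neg, smul_smul,
    Matrix.one_mul]
  rcases hs with rfl | rfl <;> simp

lemma mul_eigenProj {s : ℂ} (hs : s = 1 ∨ s = -1) {P : Matrix ι ι ℂ} (hPP : P * P = 1) :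
    P * eigenProj s P = s • eigenProj s P := by
  rw [eigenProj, Matrix.mul_smul, Matrix.mul_add, Matrix.mul_smul, hPP]
  rcases hs with rfl | rfl
  · simp [add_comm]
  · simp [smul_add, add_comm]

lemma eigenProj_mul_self {s : ℂ} (hs : s = 1 ∨ s = -1) {P : Matrix ι ι ℂ} (hPP : P * P = 1) :
    eigenProj s P * eigenProj s P = eigenProj s P :=
  eigenProj_mul_of_eq hs (mul_eigenProj hs hPP)

/-- The three ways in which an eigenprojector can act on a flat matrix. -/
lemma Flat.eigenProj_cases {D P : Matrix ι ι ℂ} (hD : Flat S D) (hS : IsPauliFamily S)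
    (hP : P ∈ S) {s : ℂ} (hs : s = 1 ∨ s = -1) :
    (P * D).trace = 0 ∨ eigenProj s P * D * eigenProj s P = D ∨
      eigenProj s P * D * eigenProj s P = 0 := by
  have key : ∀ e : ℂ, (e = 1 ∨ e = -1) → P * D = e • D →
      eigenProj s P * D * eigenProj s P = D ∨ eigenProj s P * D * eigenProj s P = 0 := by
    intro e he h
    have h' : s = e ∨ s = -e := by
      rcases hs with rfl | rfl <;> rcases he with rfl | rfl <;> simp
    rcases h' with rfl | rfl
    · left
      have h1 := eigenProj_mul_of_eq hs h
      have h2 := congrArg conjTranspose h1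
      rw [conjTranspose_mul, hD.posSemidef.isHermitian.eq,
        (eigenProj_isHermitian hs (hS.isHermitian P hP)).eq] at h2
      rw [h1, h2]
    · right
      rw [eigenProj_mul_of_eq_neg hs (by simp [h]), Matrix.zero_mul]
  rcases hD.trace_mul P hP with h | h | h
  · exact .inl h
  · exact .inr (key 1 (.inl rfl) (by
      rw [mul_eq_self_of_trace_eq hD.posSemidef (hS.isHermitian P hP) (hS.mul_self P hP) h,
        one_smul]))
  · exact .inr (key (-1) (.inr rfl) (by
      rw [mul_eq_neg_of_trace_eq hD.posSemidef (hS.isHermitian P hP) (hS.mul_self P hP) h,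
        neg_smul, one_smul]))

/-- If `P` and `R` anticommute, compression by the eigenprojector of `P` annihilates `R`; if they
commute, it replaces `R` by the average of `R` and `±P R`. The phase `c` in `P R = c R'` decides:
taking adjoints gives `R P = star c • R'`, so the two commute exactly when `c` is real. -/
lemma IsPauliFamily.trace_eigenProj (hS : IsPauliFamily S) {P R : Matrix ι ι ℂ} (hP : P ∈ S)
    (hR : R ∈ S) :
    (∀ D, ∀ s : ℂ, s = 1 ∨ s = -1 → (R * (eigenProj s P * D * eigenProj s P)).trace = 0) ∨
    ∃ R' ∈ S, ∃ e : ℂ, (e = 1 ∨ e = -1) ∧ P * R = e • R' ∧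
      ∀ D, ∀ s : ℂ, s = 1 ∨ s = -1 → (R * (eigenProj s P * D * eigenProj s P)).trace
        = (1 / 2 : ℂ) * ((R * D).trace + s * e * (R' * D).trace) := by
  obtain ⟨R', hR', c, hc, h⟩ := hS.mul_mem P hP R hR
  have hRP : R * P = star c • R' := by
    have := congrArg conjTranspose h
    rwa [conjTranspose_mul, conjTranspose_smul, (hS.isHermitian P hP).eq,
      (hS.isHermitian R hR).eq, (hS.isHermitian R' hR').eq] at this
  have hcyc : ∀ (D : Matrix ι ι ℂ) (s : ℂ), (R * (eigenProj s P * D * eigenProj s P)).trace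
      = (eigenProj s P * R * eigenProj s P * D).trace := by
    intro D s
    rw [← Matrix.mul_assoc, trace_mul_comm]
    simp only [Matrix.mul_assoc]
  rcases fourth_root_cases hc with he | he
  · refine .inr ⟨R', hR', c, he, h, fun D s hs => ?_⟩
    have hcomm : R * P = P * R := by
      rw [hRP, h]
      rcases he with rfl | rfl <;> simp
    have h1 : eigenProj s P * R = R * eigenProj s P := by
      simp [eigenProj, Matrix.add_mul, Matrix.mul_add, hcomm]
    have h2 : eigenProj s P * R = (1 / 2 : ℂ) • (R + (s * c) • R') := by
      simp only [eigenProj, Matrix.smul_mul, Matrix.add_mul, Matrix.one_mul, h, smul_smul]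
    rw [hcyc, h1, Matrix.mul_assoc R, eigenProj_mul_self hs (hS.mul_self P hP), ← h1, h2]
    simp [Matrix.add_mul, mul_add]
  · refine .inl fun D s hs => ?_
    have hcomm : P * R = -(R * P) := by
      rw [hRP, h]
      rcases he with rfl | rfl <;> simp
    have h1 : eigenProj s P * R * eigenProj s P = 0 := by
      rw [Matrix.mul_assoc]
      apply eigenProj_mul_of_eq_neg hs
      rw [← Matrix.mul_assoc, hcomm, Matrix.neg_mul, Matrix.mul_assoc,
        mul_eigenProj hs (hS.mul_self P hP), Matrix.mul_smul]
    rw [hcyc, h1, Matrix.zero_mul, trace_zero]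

/-- If both coefficients were nonzero, `R` and `R'` would act on `D` as signs, hence so would `P =
±R' R`, which together with `tr (P D) = 0` forces `tr D = 0`. Consequently the average of two
coefficients that a measurement produces has at most one nonzero term. -/
lemma Flat.trace_eq_zero_or {D P R R' : Matrix ι ι ℂ} (hD : Flat S D) (hS : IsPauliFamily S)
    (hR : R ∈ S) (hR' : R' ∈ S) {e : ℂ} (he : e = 1 ∨ e = -1) (h : P * R = e • R')
    (h0 : (P * D).trace = 0) : (R * D).trace = 0 ∨ (R' * D).trace = 0 := by
  have key : ∀ Q ∈ S, (Q * D).trace = 0 ∨ ∃ a : ℂ, (a = 1 ∨ a = -1) ∧ Q * D = a • D := by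
    intro Q hQ
    rcases hD.trace_mul Q hQ with h | h | h
    · exact .inl h
    · exact .inr ⟨1, .inl rfl, by
        rw [mul_eq_self_of_trace_eq hD.posSemidef (hS.isHermitian Q hQ) (hS.mul_self Q hQ) h,
          one_smul]⟩
    · exact .inr ⟨-1, .inr rfl, by
        rw [mul_eq_neg_of_trace_eq hD.posSemidef (hS.isHermitian Q hQ) (hS.mul_self Q hQ) h,
          neg_smul, one_smul]⟩
  rcases key R hR with h1 | ⟨a, ha, h1⟩
  · exact .inl h1
  rcases key R' hR' with h2 | ⟨b, hb, h2⟩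
  · exact .inr h2
  left
  have h3 : a • (P * D) = (e * b) • D := by
    rw [← Matrix.mul_smul, ← h1, ← Matrix.mul_assoc, h, Matrix.smul_mul, h2, smul_smul]
  have h4 := congrArg trace h3
  rw [trace_smul, trace_smul, h0, smul_zero, smul_eq_mul, eq_comm, mul_eq_zero] at h4
  have h5 : D.trace = 0 := by
    rcases h4 with h4 | h4
    · rcases he with rfl | rfl <;> rcases hb with rfl | rfl <;> norm_num at h4
    · exact h4
  rw [h1, trace_smul, h5, smul_zero]

/-- This is the usual dichotomy for stabilizer measurements: a determined outcome keeps or kills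
`D`, and an undetermined one halves the trace and every surviving coefficient alike. -/
lemma Flat.project {D P : Matrix ι ι ℂ} (hD : Flat S D) (hS : IsPauliFamily S) (hP : P ∈ S)
    {s : ℂ} (hs : s = 1 ∨ s = -1) : Flat S (eigenProj s P * D * eigenProj s P) := by
  rcases hD.eigenProj_cases hS hP hs with h0 | h | h
  · refine ⟨?_, fun R hR => ?_⟩
    · have := hD.posSemidef.mul_mul_conjTranspose_same (eigenProj s P)
      rwa [(eigenProj_isHermitian hs (hS.isHermitian P hP)).eq] at this
    · have ht : (eigenProj s P * D * eigenProj s P).trace = (1 / 2 : ℂ) * D.trace := by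
        rw [trace_mul_comm, ← Matrix.mul_assoc, eigenProj_mul_self hs (hS.mul_self P hP), eigenProj,
          Matrix.smul_mul, Matrix.add_mul, Matrix.smul_mul, trace_smul, trace_add, trace_smul, h0]
        simp
      rcases hS.trace_eigenProj hP hR with h | ⟨R', hR', e, he, h, h'⟩
      · exact .inl (h D s hs)
      · rw [ht, h' D s hs]
        have hse : s * e = 1 ∨ s * e = -1 := by
          rcases hs with rfl | rfl <;> rcases he with rfl | rfl <;> simp
        rcases hD.trace_eq_zero_or hS hR hR' he h h0 with h1 | h1 <;> rw [h1]
        · rcases hD.trace_mul R' hR' with h2 | h2 | h2 <;> rcases hse with h3 | h3 <;>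
            simp [h2, h3]
        · rcases hD.trace_mul R hR with h2 | h2 | h2 <;> simp [h2]
  · rwa [h]
  · rw [h]; exact .zero

/-- For nonzero matched matrices the outcome is undetermined for both or for neither. In the first
case the same single term survives on both sides; in the second each matrix is kept or killed, and
this is why `Matched` has to allow for zero. -/
lemma Matched.project {D₀ D₁ P : Matrix ι ι ℂ} (hD : Matched S D₀ D₁) (hS : IsPauliFamily S) (hD₀ : Flat S D₀)
    (hD₁ : Flat S D₁) (hP : P ∈ S) {s : ℂ} (hs : s = 1 ∨ s = -1) :
    Matched S (eigenProj s P * D₀ * eigenProj s P) (eigenProj s P * D₁ * eigenProj s P) := by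
  by_cases h00 : D₀ = 0
  · exact .inl (by simp [h00])
  by_cases h11 : D₁ = 0
  · exact .inr (.inl (by simp [h11]))
  have hm := (hD.resolve_left h00).resolve_left h11
  by_cases h0 : (P * D₀).trace = 0
  · have h1 : (P * D₁).trace = 0 := by
      rcases hm P hP with h | h
      · rw [← h, h0]
      · rw [h0, eq_comm, neg_eq_zero] at h; exact h
    refine .inr (.inr fun R hR => ?_)
    rcases hS.trace_eigenProj hP hR with h | ⟨R', hR', e, he, h, h'⟩
    · exact .inl (by rw [h D₀ s hs, h D₁ s hs])
    · rw [h' D₀ s hs, h' D₁ s hs]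
      rcases hD₀.trace_eq_zero_or hS hR hR' he h h0 with h2 | h2
      · have h3 : (R * D₁).trace = 0 := by
          rcases hm R hR with h | h
          · rw [← h, h2]
          · rw [h2, eq_comm, neg_eq_zero] at h; exact h
        rw [h2, h3]
        rcases hm R' hR' with h | h <;> simp [h]
      · have h3 : (R' * D₁).trace = 0 := by
          rcases hm R' hR' with h | h
          · rw [← h, h2]
          · rw [h2, eq_comm, neg_eq_zero] at h; exact h
        rw [h2, h3]
        rcases hm R hR with h | h <;> simp [h]
  · have h1 : (P * D₁).trace ≠ 0 := by
      rcases hm P hP with h | h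
      · rwa [← h]
      · intro h'; rw [h', neg_zero] at h; exact h0 h
    rcases (hD₀.eigenProj_cases hS hP hs).resolve_left h0 with h | h
    · rcases (hD₁.eigenProj_cases hS hP hs).resolve_left h1 with h' | h'
      · rw [h, h']; exact hD
      · exact .inr (.inl h')
    · exact .inl h

lemma Flat.matched_eigenProj {D P : Matrix ι ι ℂ} (hD : Flat S D) (hS : IsPauliFamily S)
    (hP : P ∈ S) (h0 : (P * D).trace = 0) :
    Matched S (eigenProj 1 P * D * eigenProj 1 P) (eigenProj (-1) P * D * eigenProj (-1) P) := by
  refine .inr (.inr fun R hR => ?_)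
  rcases hS.trace_eigenProj hP hR with h | ⟨R', hR', e, he, h, h'⟩
  · exact .inl (by rw [h D 1 (.inl rfl), h D (-1) (.inr rfl)])
  · rw [h' D 1 (.inl rfl), h' D (-1) (.inr rfl)]
    rcases hD.trace_eq_zero_or hS hR hR' he h h0 with h2 | h2 <;> simp [h2]

lemma Flat.submatrix_equiv {T : Set (Matrix κ κ ℂ)} {D : Matrix ι ι ℂ} (hD : Flat S D)
    (e : κ ≃ ι) (h : ∀ P ∈ T, P.submatrix e.symm e.symm ∈ S) : Flat T (D.submatrix e e) := by
  have htr : ∀ A : Matrix ι ι ℂ, (A.submatrix e e).trace = A.trace := fun A =>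
    Equiv.sum_comp e fun i => A i i
  refine hD.of_trace (hD.posSemidef.submatrix e) (htr D) fun P hP => ⟨_, h P hP, .inl ?_⟩
  rw [← htr (_ * D), ← submatrix_mul_equiv _ _ e e e]
  simp

lemma Matched.submatrix_equiv {T : Set (Matrix κ κ ℂ)} {D₀ D₁ : Matrix ι ι ℂ}
    (hD : Matched S D₀ D₁) (e : κ ≃ ι) (h : ∀ P ∈ T, P.submatrix e.symm e.symm ∈ S) :
    Matched T (D₀.submatrix e e) (D₁.submatrix e e) := by
  have htr : ∀ A : Matrix ι ι ℂ, (A.submatrix e e).trace = A.trace := fun A =>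
    Equiv.sum_comp e fun i => A i i
  refine hD.of_trace (by rintro rfl; rfl) (by rintro rfl; rfl) fun P hP =>
    ⟨_, h P hP, 1, ?_, ?_⟩ <;>
  · rw [one_mul, ← htr (_ * _), ← submatrix_mul_equiv _ _ e e e]
    simp

lemma trace_mul_eq_submatrix {j : κ → ι} (hj : Function.Injective j) {A : Matrix ι ι ℂ}
    (hA : ∀ x y, x ∉ Set.range j ∨ y ∉ Set.range j → A x y = 0) (B : Matrix ι ι ℂ) :
    (B * A).trace = (B.submatrix j j * A.submatrix j j).trace := by
  simp only [trace, diag_apply, mul_apply, submatrix_apply]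
  refine (Fintype.sum_of_injective j hj _ _ (fun x hx => ?_) fun x => ?_).symm
  · exact Finset.sum_eq_zero fun y _ => by rw [hA y x (.inr hx), mul_zero]
  · exact Fintype.sum_of_injective j hj _ _ (fun y hy => by rw [hA y _ (.inl hy), mul_zero])
      fun _ => rfl

lemma support_eigenProj {j : κ → ι} {P : Matrix ι ι ℂ} {s : ℂ} [DecidablePred (· ∈ Set.range j)]
    (hP : eigenProj s P = diagonal fun x => if x ∈ Set.range j then 1 else 0) (D : Matrix ι ι ℂ) :
    (∀ x y, x ∉ Set.range j ∨ y ∉ Set.range j → (eigenProj s P * D * eigenProj s P) x y = 0) ∧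
      (eigenProj s P * D * eigenProj s P).submatrix j j = D.submatrix j j := by
  rw [hP]
  constructor
  · intro x y h
    rw [mul_diagonal, diagonal_mul]
    rcases h with h | h <;> simp only [if_neg h, zero_mul, mul_zero]
  · ext x y
    simp [mul_diagonal, diagonal_mul]

/-- Fixing a basis value of a qubit is a projection onto an eigenspace of its `Z`, followed by
dropping the rows and columns that have become zero; `j` embeds the remaining labels. -/
lemma Flat.contract (hS : IsPauliFamily S) {T : Set (Matrix κ κ ℂ)} {D P : Matrix ι ι ℂ}
    (hD : Flat S D) {j : κ → ι} (hj : Function.Injective j) {s : ℂ} (hs : s = 1 ∨ s = -1)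
    (hP : P ∈ S) [DecidablePred (· ∈ Set.range j)]
    (hPj : eigenProj s P = diagonal fun x => if x ∈ Set.range j then 1 else 0)
    (h : ∀ R ∈ T, ∃ R' ∈ S, R'.submatrix j j = R) : Flat T (D.submatrix j j) := by
  obtain ⟨h1, h2⟩ := support_eigenProj hPj D
  refine (hD.project hS hP hs).of_trace (hD.posSemidef.submatrix j) ?_ fun R hR => ?_
  · have := trace_mul_eq_submatrix hj h1 1
    rw [one_mul, h2] at this
    rw [this, submatrix_one j hj, one_mul]
  · obtain ⟨R', hR', h⟩ := h R hR
    exact ⟨R', hR', .inl (by rw [trace_mul_eq_submatrix hj h1, h2, h])⟩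

lemma Matched.contract (hS : IsPauliFamily S) {T : Set (Matrix κ κ ℂ)} {D₀ D₁ P : Matrix ι ι ℂ}
    (hD₀ : Flat S D₀) (hD₁ : Flat S D₁) (hD : Matched S D₀ D₁)
    {j : κ → ι} (hj : Function.Injective j) {s : ℂ} (hs : s = 1 ∨ s = -1)
    (hP : P ∈ S) [DecidablePred (· ∈ Set.range j)]
    (hPj : eigenProj s P = diagonal fun x => if x ∈ Set.range j then 1 else 0)
    (h : ∀ R ∈ T, ∃ R' ∈ S, R'.submatrix j j = R) :
    Matched T (D₀.submatrix j j) (D₁.submatrix j j) := by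
  obtain ⟨h1, h2⟩ := support_eigenProj hPj D₀
  obtain ⟨h1', h2'⟩ := support_eigenProj hPj D₁
  refine (hD.project hS hD₀ hD₁ hP hs).of_trace (fun h0 => ?_) (fun h0 => ?_) fun R hR => ?_
  · rw [← h2, h0]; rfl
  · rw [← h2', h0]; rfl
  · obtain ⟨R', hR', h⟩ := h R hR
    exact ⟨R', hR', 1, by rw [one_mul, trace_mul_eq_submatrix hj h1, h2, h],
      by rw [one_mul, trace_mul_eq_submatrix hj h1', h2', h]⟩

end Flat

/-! ### Products of one-qubit operators and the algebra of Pauli strings -/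

section TensorProduct

/-- The tensor product of one-qubit operators. -/
def tensorProd {n : ℕ} (A : Fin n → Op₁) : Op n := of fun x y => ∏ i, A i (x i) (y i)

lemma tensorProd_mul {n : ℕ} (A B : Fin n → Op₁) :
    tensorProd A * tensorProd B = tensorProd fun i => A i * B i := by
  ext x y
  simp only [tensorProd, mul_apply, of_apply, ← Finset.prod_mul_distrib, Finset.prod_univ_sum,
    Fintype.piFinset_univ]

lemma tensorProd_conjTranspose {n : ℕ} (A : Fin n → Op₁) :
    (tensorProd A)ᴴ = tensorProd fun i => (A i)ᴴ := by
  ext x y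
  simp [tensorProd, conjTranspose_apply]

lemma trace_tensorProd {n : ℕ} (A : Fin n → Op₁) : (tensorProd A).trace = ∏ i, (A i).trace := by
  simp only [tensorProd, trace, diag_apply, of_apply, Finset.prod_univ_sum, Fintype.piFinset_univ]

lemma tensorProd_smul {n : ℕ} (c : Fin n → ℂ) (A : Fin n → Op₁) :
    (tensorProd fun i => c i • A i) = (∏ i, c i) • tensorProd A := by
  ext x y
  simp [tensorProd, Finset.prod_mul_distrib]

lemma tensorProd_diagonal {n : ℕ} (d : Fin n → Fin 2 → ℂ) :
    (tensorProd fun i => diagonal (d i)) = diagonal fun x => ∏ i, d i (x i) := by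
  ext x y
  by_cases h : x = y
  · subst h; simp [tensorProd]
  · obtain ⟨i, hi⟩ := Function.ne_iff.1 h
    rw [diagonal_apply_ne _ h]
    exact Finset.prod_eq_zero (Finset.mem_univ i) (diagonal_apply_ne _ hi)

lemma tensorProd_one {n : ℕ} : (tensorProd fun _ : Fin n => (1 : Op₁)) = 1 := by
  simp_rw [← diagonal_one, tensorProd_diagonal, Finset.prod_const_one]

lemma pauliString_eq_tensorProd {n : ℕ} (P : Fin n → Pauli) :
    pauliString P = tensorProd fun i => (P i).toMatrix := rfl

lemma Pauli.toMatrix_isHermitian (P : Pauli) : P.toMatrix.IsHermitian := by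
  cases P <;> ext i j <;> fin_cases i <;> fin_cases j <;> simp [Pauli.toMatrix]

lemma Pauli.toMatrix_mul_self (P : Pauli) : P.toMatrix * P.toMatrix = 1 := by
  cases P <;> ext i j <;> fin_cases i <;> fin_cases j <;> simp [Pauli.toMatrix, mul_apply]

lemma Pauli.toMatrix_I : Pauli.I.toMatrix = 1 := by
  ext i j; fin_cases i <;> fin_cases j <;> simp [Pauli.toMatrix]

lemma Pauli.toMatrix_Z : Pauli.Z.toMatrix = diagonal ![1, -1] := by
  ext i j; fin_cases i <;> fin_cases j <;> simp [Pauli.toMatrix]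

lemma Pauli.trace_toMatrix {P : Pauli} (hP : P ≠ .I) : P.toMatrix.trace = 0 := by
  cases P <;> simp [Pauli.toMatrix, trace, diag_apply] at *

lemma Pauli.exists_mul (P Q : Pauli) :
    ∃ R : Pauli, ∃ c : ℂ, c ^ 4 = 1 ∧ P.toMatrix * Q.toMatrix = c • R.toMatrix := by
  have hI : Complex.I ^ 4 = 1 := Complex.I_pow_four
  have hI' : (-Complex.I) ^ 4 = 1 := by rw [neg_pow, hI]; norm_num
  cases P <;> cases Q
  · exact ⟨.I, 1, one_pow 4, by rw [toMatrix_I, one_smul, Matrix.one_mul]⟩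
  · exact ⟨.X, 1, one_pow 4, by rw [toMatrix_I, one_smul, Matrix.one_mul]⟩
  · exact ⟨.Y, 1, one_pow 4, by rw [toMatrix_I, one_smul, Matrix.one_mul]⟩
  · exact ⟨.Z, 1, one_pow 4, by rw [toMatrix_I, one_smul, Matrix.one_mul]⟩
  · exact ⟨.X, 1, one_pow 4, by rw [toMatrix_I, one_smul, Matrix.mul_one]⟩
  · exact ⟨.I, 1, one_pow 4, by rw [toMatrix_I, one_smul, toMatrix_mul_self]⟩
  · exact ⟨.Z, Complex.I, hI, by
      ext i j; fin_cases i <;> fin_cases j <;> simp [toMatrix, mul_apply]⟩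
  · exact ⟨.Y, -Complex.I, hI', by
      ext i j; fin_cases i <;> fin_cases j <;> simp [toMatrix, mul_apply]⟩
  · exact ⟨.Y, 1, one_pow 4, by rw [toMatrix_I, one_smul, Matrix.mul_one]⟩
  · exact ⟨.Z, -Complex.I, hI', by
      ext i j; fin_cases i <;> fin_cases j <;> simp [toMatrix, mul_apply]⟩
  · exact ⟨.I, 1, one_pow 4, by rw [toMatrix_I, one_smul, toMatrix_mul_self]⟩
  · exact ⟨.X, Complex.I, hI, by
      ext i j; fin_cases i <;> fin_cases j <;> simp [toMatrix, mul_apply]⟩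
  · exact ⟨.Z, 1, one_pow 4, by rw [toMatrix_I, one_smul, Matrix.mul_one]⟩
  · exact ⟨.Y, Complex.I, hI, by
      ext i j; fin_cases i <;> fin_cases j <;> simp [toMatrix, mul_apply]⟩
  · exact ⟨.X, -Complex.I, hI', by
      ext i j; fin_cases i <;> fin_cases j <;> simp [toMatrix, mul_apply]⟩
  · exact ⟨.I, 1, one_pow 4, by rw [toMatrix_I, one_smul, toMatrix_mul_self]⟩

lemma pauliString_isHermitian {n : ℕ} (P : Fin n → Pauli) : (pauliString P).IsHermitian := by
  rw [IsHermitian, pauliString_eq_tensorProd, tensorProd_conjTranspose]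
  simp_rw [fun i => (Pauli.toMatrix_isHermitian (P i)).eq]

lemma pauliString_mul_self {n : ℕ} (P : Fin n → Pauli) : pauliString P * pauliString P = 1 := by
  simp_rw [pauliString_eq_tensorProd, tensorProd_mul, Pauli.toMatrix_mul_self, tensorProd_one]

lemma pauliString_I {n : ℕ} : pauliString (fun _ : Fin n => Pauli.I) = 1 := by
  simp_rw [pauliString_eq_tensorProd, Pauli.toMatrix_I, tensorProd_one]

lemma exists_pauliString_mul {n : ℕ} (P Q : Fin n → Pauli) :
    ∃ R : Fin n → Pauli, ∃ c : ℂ, c ^ 4 = 1 ∧ pauliString P * pauliString Q = c • pauliString R := by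
  choose R c hc h using fun i => Pauli.exists_mul (P i) (Q i)
  refine ⟨R, ∏ i, c i, by simp [← Finset.prod_pow, hc], ?_⟩
  simp_rw [pauliString_eq_tensorProd, tensorProd_mul, h, tensorProd_smul]

lemma trace_pauliString {n : ℕ} (P : Fin n → Pauli) :
    (pauliString P).trace = 0 ∨ pauliString P = 1 := by
  by_cases h : ∃ i, P i ≠ .I
  · obtain ⟨i, hi⟩ := h
    left
    rw [pauliString_eq_tensorProd, trace_tensorProd]
    exact Finset.prod_eq_zero (Finset.mem_univ i) (Pauli.trace_toMatrix hi)
  · push Not at h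
    obtain rfl : P = fun _ => .I := funext h
    exact .inr pauliString_I

end TensorProduct

/-! ### Pauli strings on the register together with the resource qubits -/

section RegisterPaulis

/-- Basis labels of a register of `n` qubits together with `k` resource qubits. -/
abbrev Labels (n k : ℕ) : Type := (Fin n → Fin 2) × (Fin k → Fin 2)

/-- The Pauli strings on a register of `n` qubits together with `k` resource qubits. -/
def registerPaulis (n k : ℕ) : Set (Matrix (Labels n k) (Labels n k) ℂ) :=
  {A | ∃ (P : Fin n → Pauli) (Q : Fin k → Pauli), A = pauliString P ⊗ₖ pauliString Q}

lemma isPauliFamily_registerPaulis (n k : ℕ) : IsPauliFamily (registerPaulis n k) where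
  isHermitian := by
    rintro _ ⟨P, Q, rfl⟩
    rw [IsHermitian, conjTranspose_kronecker, (pauliString_isHermitian P).eq,
      (pauliString_isHermitian Q).eq]
  mul_self := by
    rintro _ ⟨P, Q, rfl⟩
    rw [← mul_kronecker_mul, pauliString_mul_self, pauliString_mul_self, one_kronecker_one]
  mul_mem := by
    rintro _ ⟨P, Q, rfl⟩ _ ⟨P', Q', rfl⟩
    obtain ⟨R, c, hc, h⟩ := exists_pauliString_mul P P'
    obtain ⟨R', c', hc', h'⟩ := exists_pauliString_mul Q Q'
    refine ⟨_, ⟨R, R', rfl⟩, c * c', by rw [mul_pow, hc, hc', one_mul], ?_⟩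
    rw [← mul_kronecker_mul, h, h', smul_kronecker, kronecker_smul, smul_smul]

lemma pauliString_kronecker_one_mem {n : ℕ} (k : ℕ) (P : Fin n → Pauli) :
    pauliString P ⊗ₖ (1 : Op k) ∈ registerPaulis n k :=
  ⟨P, fun _ => .I, by rw [pauliString_I]⟩

lemma flat_one (n k : ℕ) : Flat (registerPaulis n k) 1 := by
  refine ⟨.one, ?_⟩
  rintro _ ⟨P, Q, rfl⟩
  rw [Matrix.mul_one, trace_kronecker]
  rcases trace_pauliString P with h | h <;> rcases trace_pauliString Q with h' | h'
  · simp [h]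
  · simp [h]
  · simp [h']
  · rw [h, h', ← trace_kronecker, one_kronecker_one]; simp

lemma pauliProj_kronecker_one {n : ℕ} (k : ℕ) (P : Fin n → Pauli) (b : Bool) :
    pauliProj P b ⊗ₖ (1 : Op k)
      = eigenProj (if b then 1 else -1) (pauliString P ⊗ₖ (1 : Op k)) := by
  cases b <;>
  · ext ⟨x, u⟩ ⟨y, v⟩
    by_cases h : x = y <;> by_cases h' : u = v <;>
      simp [pauliProj, eigenProj, one_apply, h, h', sub_eq_add_neg, mul_add]

/-- The `Z` operator on the last qubit of the register. -/
def lastZ (n k : ℕ) : Matrix (Labels (n + 1) k) (Labels (n + 1) k) ℂ :=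
  pauliString (Fin.snoc (fun _ => Pauli.I) Pauli.Z : Fin (n + 1) → Pauli) ⊗ₖ (1 : Op k)

/-- Fixing the value of the last qubit of the register. -/
def appendBit {n k : ℕ} (a : Fin 2) (z : Labels n k) : Labels (n + 1) k := (Fin.snoc (α := fun _ => Fin 2) z.1 a, z.2)

lemma appendBit_injective {n k : ℕ} (a : Fin 2) :
    Function.Injective (appendBit a : Labels n k → Labels (n + 1) k) := by
  rintro ⟨x, u⟩ ⟨y, v⟩ h
  simp only [appendBit, Prod.mk.injEq] at h
  rw [Prod.mk.injEq]
  exact ⟨(Fin.snoc_injective2 h.1).1, h.2⟩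

lemma mem_range_appendBit {n k : ℕ} {a : Fin 2} {z : Labels (n + 1) k} :
    z ∈ Set.range (appendBit a : Labels n k → Labels (n + 1) k) ↔ z.1 (Fin.last n) = a := by
  constructor
  · rintro ⟨w, rfl⟩; simp [appendBit]
  · rintro rfl
    exact ⟨(Fin.init z.1, z.2), by simp [appendBit]⟩

/-- The sign by which `Z` acts on a basis vector. -/
def bitSign (a : Fin 2) : ℂ := ![1, -1] a

lemma bitSign_cases (a : Fin 2) : bitSign a = 1 ∨ bitSign a = -1 := by
  fin_cases a <;> simp [bitSign]

lemma eigenProj_diagonal {ι : Type*} [Fintype ι] [DecidableEq ι] (a : Fin 2) (f : ι → Fin 2) :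
    eigenProj (bitSign a) (diagonal fun x => bitSign (f x))
      = diagonal fun x => if f x = a then 1 else 0 := by
  ext x y
  by_cases h : x = y
  · subst h
    generalize hb : f x = b
    fin_cases a <;> fin_cases b <;> simp [eigenProj, bitSign, hb] <;> norm_num
  · simp [eigenProj, h]

lemma eigenProj_lastZ {n k : ℕ} (a : Fin 2)
    [DecidablePred (· ∈ Set.range (appendBit a : Labels n k → Labels (n + 1) k))] :
    eigenProj (bitSign a) (lastZ n k) = diagonal fun x =>
      if x ∈ Set.range (appendBit a : Labels n k → Labels (n + 1) k) then 1 else 0 := by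
  have : lastZ n k = diagonal fun x => bitSign (x.1 (Fin.last n)) := by
    have h : pauliString (Fin.snoc (fun _ => Pauli.I) Pauli.Z : Fin (n + 1) → Pauli)
        = diagonal fun x => bitSign (x (Fin.last n)) := by
      rw [pauliString_eq_tensorProd]
      have : (fun i => ((Fin.snoc (fun _ => Pauli.I) Pauli.Z : Fin (n + 1) → Pauli) i).toMatrix)
          = fun i => diagonal ((Fin.snoc (fun _ => 1) bitSign : Fin (n + 1) → Fin 2 → ℂ) i) := by
        funext i
        induction i using Fin.lastCases with
        | last => simp only [Fin.snoc_last, Pauli.toMatrix_Z]; rfl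
        | cast i => simp only [Fin.snoc_castSucc, Pauli.toMatrix_I]; exact diagonal_one.symm
      rw [this, tensorProd_diagonal]
      simp [Fin.prod_univ_castSucc]
    rw [lastZ, h, ← diagonal_one, diagonal_kronecker_diagonal]
    simp
  rw [this, eigenProj_diagonal]
  simp_rw [mem_range_appendBit]

lemma lastZ_mem (n k : ℕ) : lastZ n k ∈ registerPaulis (n + 1) k :=
  pauliString_kronecker_one_mem k _

lemma exists_submatrix_appendBit {n k : ℕ} (a : Fin 2) :
    ∀ R ∈ registerPaulis n k, ∃ R' ∈ registerPaulis (n + 1) k,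
      R'.submatrix (appendBit a) (appendBit a) = R := by
  rintro _ ⟨P, Q, rfl⟩
  refine ⟨_, ⟨Fin.snoc P .I, Q, rfl⟩, ?_⟩
  ext ⟨x, u⟩ ⟨y, v⟩
  simp only [appendBit, submatrix_apply, kronecker_apply, pauliString, of_apply,
    Fin.prod_univ_castSucc, Fin.snoc_castSucc, Fin.snoc_last]
  rw [Pauli.toMatrix_I, one_apply_eq, mul_one]

/-- Moving the last qubit of the register to the resource qubits. -/
def moveLast (n k : ℕ) : Labels n (k + 1) ≃ Labels (n + 1) k where
  toFun z := (Fin.snoc (α := fun _ => Fin 2) z.1 (z.2 0), Fin.tail z.2)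
  invFun z := (Fin.init z.1, Fin.cons (z.1 (Fin.last n)) z.2)
  left_inv z := by simp
  right_inv z := by simp

lemma submatrix_moveLast_mem {n k : ℕ} :
    ∀ R ∈ registerPaulis n (k + 1),
      R.submatrix (moveLast n k).symm (moveLast n k).symm ∈ registerPaulis (n + 1) k := by
  rintro _ ⟨P, Q, rfl⟩
  refine ⟨Fin.snoc P (Q 0), Fin.tail Q, ?_⟩
  ext ⟨x, u⟩ ⟨y, v⟩
  simp only [moveLast, Equiv.coe_fn_symm_mk, submatrix_apply, kronecker_apply, pauliString,
    of_apply, Fin.prod_univ_succ (n := k), Fin.prod_univ_castSucc (n := n), Fin.cons_zero,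
    Fin.cons_succ, Fin.snoc_castSucc, Fin.snoc_last, Fin.init, Fin.tail, mul_assoc]

/-- The phase can only be a sign because the conjugate of an involution is an involution. -/
lemma IsClifford.exists_pauliString {n : ℕ} {U : Op n} (hU : IsClifford U) (P : Fin n → Pauli) :
    ∃ (R : Fin n → Pauli) (e : ℂ), (e = 1 ∨ e = -1) ∧ U * pauliString P * Uᴴ = e • pauliString R := by
  obtain ⟨k, R, h⟩ := hU.2 (pauliString P) ⟨0, P, by simp⟩
  refine ⟨R, _, ?_, h⟩
  have hUU : Uᴴ * U = 1 := (Matrix.mem_unitaryGroup_iff'.1 hU.1)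
  have hUU' : U * Uᴴ = 1 := (Matrix.mem_unitaryGroup_iff.1 hU.1)
  have h1 : (U * pauliString P * Uᴴ) * (U * pauliString P * Uᴴ) = 1 := by
    calc _ = U * (pauliString P * (Uᴴ * U) * pauliString P) * Uᴴ := by simp only [Matrix.mul_assoc]
      _ = 1 := by rw [hUU, Matrix.mul_one, pauliString_mul_self, Matrix.mul_one, hUU']
  rw [h, smul_mul_smul_comm, pauliString_mul_self] at h1
  have h2 := congrFun (congrFun h1 0) 0
  simp only [Matrix.smul_apply, one_apply_eq, smul_eq_mul, mul_one] at h2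
  exact mul_self_eq_one_iff.1 h2

end RegisterPaulis

/-! ### Runs in the Heisenberg picture -/

section Runs

/-- The number of copies of `|T⟩` in a resource state. -/
def Resource.countT : Resource → ℕ
  | .T => 1
  | .rootT => 0
  | .rootTCubed => 0

/-- The number of copies of `|√T⟩` or `|√T³⟩` in a resource state. -/
def Resource.countRootT : Resource → ℕ
  | .T => 0
  | .rootT => 1
  | .rootTCubed => 1

/-- The joint state of the resource qubits. -/
def resourceState {k : ℕ} (res : Fin k → Resource) : Op k :=
  tensorProd fun i => pureState (res i).ket

/-- A run is represented by flat operators on the register and the resource qubits whose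
expectation values are the diagonal entries of the output. -/
structure Run.Represents {n k : ℕ} (r : Run n) (res : Fin k → Resource)
    (D : Fin 2 → Matrix (Labels n k) (Labels n k) ℂ) : Prop where
  flat : ∀ b, Flat (registerPaulis n k) (D b)
  matched : Matched (registerPaulis n k) (D 0) (D 1)
  map_apply : ∀ ρ b, r.map ρ b b = (D b * (ρ ⊗ₖ resourceState res)).trace
  numT_eq : r.numT = ∑ i, (res i).countT
  numRootT_eq : r.numRootT = ∑ i, (res i).countRootT

/-- The induction along the protocol tree starts here: measuring the output qubit corresponds to the
two eigenprojectors of `Z` on qubit `j`. They arise by projecting the flat operator `1`, and they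
are matched because `Z` is traceless. -/
lemma Run.Represents.output {n : ℕ} (j : Fin n) :
    ∃ D, (⟨0, 0, keepQubit j⟩ : Run n).Represents (Fin.elim0 : Fin 0 → Resource) D := by
  set Z := pauliString (Function.update (fun _ => Pauli.I) j .Z) ⊗ₖ (1 : Op 0) with hZ
  have hmem : Z ∈ registerPaulis n 0 := pauliString_kronecker_one_mem 0 _
  have hdiag : Z = diagonal fun z => bitSign (z.1 j) := by
    have h : pauliString (Function.update (fun _ => Pauli.I) j .Z)
        = diagonal fun x => bitSign (x j) := by
      rw [pauliString_eq_tensorProd]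
      have : (fun i => (Function.update (fun _ => Pauli.I) j .Z i).toMatrix)
          = fun i => diagonal ((Function.update (fun _ => 1) j bitSign : Fin n → Fin 2 → ℂ) i) := by
        funext i
        by_cases h : i = j
        · subst h; simp only [Function.update_self, Pauli.toMatrix_Z]; rfl
        · simp only [Function.update_of_ne h, Pauli.toMatrix_I]; exact diagonal_one.symm
      rw [this, tensorProd_diagonal]
      congr 1
      funext x
      rw [Finset.prod_eq_single j]
      · simp
      · intro i _ h; simp [Function.update_of_ne h]
      · simp
    rw [hZ, h, ← diagonal_one, diagonal_kronecker_diagonal]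
    simp
  have hS := isPauliFamily_registerPaulis n 0
  have htr : (Z * 1).trace = 0 := by
    rw [Matrix.mul_one, hZ, trace_kronecker, pauliString_eq_tensorProd, trace_tensorProd,
      Finset.prod_eq_zero (Finset.mem_univ j), zero_mul]
    simp [Pauli.trace_toMatrix]
  refine ⟨fun b => eigenProj (bitSign b) Z * 1 * eigenProj (bitSign b) Z,
    fun b => (flat_one n 0).project hS hmem (bitSign_cases b),
    (flat_one n 0).matched_eigenProj hS hmem htr, fun ρ b => ?_, rfl, rfl⟩
  rw [Matrix.mul_one, eigenProj_mul_self (bitSign_cases b) (hS.mul_self Z hmem), hdiag,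
    eigenProj_diagonal]
  simp [trace, diagonal_mul, keepQubit, Fintype.sum_prod_type, resourceState, tensorProd]
  refine Finset.sum_congr rfl fun x _ => ?_
  split_ifs with h
  · rw [← h, Function.update_eq_self]
  · rfl

lemma conj_kronecker {n k : ℕ} (K ρ : Op n) (σ : Op k) :
    (K * ρ * Kᴴ) ⊗ₖ σ = (K ⊗ₖ (1 : Op k)) * (ρ ⊗ₖ σ) * (K ⊗ₖ (1 : Op k))ᴴ := by
  rw [conjTranspose_kronecker, ← mul_kronecker_mul, ← mul_kronecker_mul]
  simp

lemma Run.Represents.conjBy {n k : ℕ} {r : Run n} {res : Fin k → Resource}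
    {D : Fin 2 → Matrix (Labels n k) (Labels n k) ℂ} (h : r.Represents res D) (K : Op n)
    (hflat : ∀ b, Flat (registerPaulis n k) ((K ⊗ₖ (1 : Op k))ᴴ * D b * (K ⊗ₖ (1 : Op k))))
    (hmatched : Matched (registerPaulis n k) ((K ⊗ₖ (1 : Op k))ᴴ * D 0 * (K ⊗ₖ (1 : Op k)))
      ((K ⊗ₖ (1 : Op k))ᴴ * D 1 * (K ⊗ₖ (1 : Op k)))) :
    (r.after (StabSynth.conjBy K)).Represents res
      fun b => (K ⊗ₖ (1 : Op k))ᴴ * D b * (K ⊗ₖ (1 : Op k)) := by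
  refine ⟨hflat, hmatched, fun ρ b => ?_, h.numT_eq, h.numRootT_eq⟩
  change r.map (K * ρ * Kᴴ) b b = _
  rw [h.map_apply, conj_kronecker, ← Matrix.mul_assoc, trace_mul_comm]
  simp only [Matrix.mul_assoc]

lemma Run.Represents.clifford {n k : ℕ} {r : Run n} {res : Fin k → Resource}
    {D : Fin 2 → Matrix (Labels n k) (Labels n k) ℂ} (h : r.Represents res D) {U : Op n}
    (hU : IsClifford U) : ∃ D, (r.after (StabSynth.conjBy U)).Represents res D := by
  have hW : (U ⊗ₖ (1 : Op k)) * (U ⊗ₖ (1 : Op k))ᴴ = 1 := by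
    rw [conjTranspose_kronecker, ← mul_kronecker_mul, conjTranspose_one, Matrix.mul_one,
      ← star_eq_conjTranspose, Matrix.mem_unitaryGroup_iff.1 hU.1, one_kronecker_one]
  have key : ∀ A ∈ registerPaulis n k, ∃ R ∈ registerPaulis n k, ∃ e : ℂ, (e = 1 ∨ e = -1) ∧
      ∀ D, (A * ((U ⊗ₖ (1 : Op k))ᴴ * D * (U ⊗ₖ (1 : Op k)))).trace = e * (R * D).trace := by
    rintro _ ⟨P, Q, rfl⟩
    obtain ⟨R, e, he, hR⟩ := hU.exists_pauliString P
    refine ⟨_, ⟨R, Q, rfl⟩, e, he, fun D => ?_⟩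
    rw [← Matrix.mul_assoc, trace_mul_comm, ← Matrix.mul_assoc, ← Matrix.mul_assoc,
      ← conj_kronecker, hR, smul_kronecker, Matrix.smul_mul, trace_smul, smul_eq_mul]
  refine ⟨_, h.conjBy U (fun b => (h.flat b).of_trace ?_ ?_ fun A hA => ?_)
    (h.matched.of_trace (fun h0 => by simp [h0]) (fun h0 => by simp [h0]) fun A hA => ?_)⟩
  · exact (h.flat b).posSemidef.conjTranspose_mul_mul_same _
  · rw [trace_mul_comm, ← Matrix.mul_assoc, hW, Matrix.one_mul]
  · obtain ⟨R, hR, e, he, h⟩ := key A hA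
    refine ⟨R, hR, ?_⟩
    rw [h]
    rcases he with rfl | rfl <;> simp
  · obtain ⟨R, hR, e, he, h⟩ := key A hA
    exact ⟨R, hR, e, h _, h _⟩

lemma Run.Represents.measure {n k : ℕ} {r : Run n} {res : Fin k → Resource}
    {D : Fin 2 → Matrix (Labels n k) (Labels n k) ℂ} (h : r.Represents res D) (P : Fin n → Pauli)
    (a : Bool) : ∃ D, (r.after (StabSynth.conjBy (pauliProj P a))).Represents res D := by
  have hS := isPauliFamily_registerPaulis n k
  have hP := pauliString_kronecker_one_mem k P
  have hs : (if a then 1 else -1 : ℂ) = 1 ∨ (if a then 1 else -1 : ℂ) = -1 := by cases a <;> simp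
  have hH := (eigenProj_isHermitian hs (hS.isHermitian _ hP)).eq
  refine ⟨_, h.conjBy _ (fun b => ?_) ?_⟩ <;> rw [pauliProj_kronecker_one, hH]
  · exact (h.flat b).project hS hP hs
  · exact h.matched.project hS (h.flat 0) (h.flat 1) hP hs

lemma Run.Represents.coin {n k : ℕ} {r : Run n} {res : Fin k → Resource}
    {D : Fin 2 → Matrix (Labels n k) (Labels n k) ℂ} (h : r.Represents res D) {p : ℝ}
    (hp : 0 ≤ p) : (r.after ((p : ℂ) • LinearMap.id)).Represents res fun b => (p : ℂ) • D b := by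
  refine ⟨fun b => (h.flat b).smul hp, h.matched.smul p, fun ρ b => ?_, h.numT_eq, h.numRootT_eq⟩
  change r.map ((p : ℂ) • ρ) b b = _
  rw [map_smul, Matrix.smul_apply, h.map_apply, Matrix.smul_mul, trace_smul]

lemma Flat.contract_lastBit {n k : ℕ} {D : Matrix (Labels (n + 1) k) (Labels (n + 1) k) ℂ}
    (hD : Flat (registerPaulis (n + 1) k) D) (a : Fin 2) :
    Flat (registerPaulis n k) (D.submatrix (appendBit a) (appendBit a)) := by
  classical
  exact hD.contract (isPauliFamily_registerPaulis _ _) (appendBit_injective a) (bitSign_cases a)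
    (lastZ_mem n k) (eigenProj_lastZ a) (exists_submatrix_appendBit a)

lemma Matched.contract_lastBit {n k : ℕ} {D₀ D₁ : Matrix (Labels (n + 1) k) (Labels (n + 1) k) ℂ}
    (hD : Matched (registerPaulis (n + 1) k) D₀ D₁) (h₀ : Flat (registerPaulis (n + 1) k) D₀)
    (h₁ : Flat (registerPaulis (n + 1) k) D₁) (a : Fin 2) :
    Matched (registerPaulis n k) (D₀.submatrix (appendBit a) (appendBit a))
      (D₁.submatrix (appendBit a) (appendBit a)) := by
  classical
  exact hD.contract (isPauliFamily_registerPaulis _ _) h₀ h₁ (appendBit_injective a)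
    (bitSign_cases a) (lastZ_mem n k) (eigenProj_lastZ a) (exists_submatrix_appendBit a)

lemma Run.Represents.appendBasis {n k : ℕ} {r : Run (n + 1)} {res : Fin k → Resource}
    {D : Fin 2 → Matrix (Labels (n + 1) k) (Labels (n + 1) k) ℂ} (h : r.Represents res D)
    (a : Fin 2) : (r.after (appendQubit (Matrix.single a a 1))).Represents res
      fun b => (D b).submatrix (appendBit a) (appendBit a) := by
  refine ⟨fun b => (h.flat b).contract_lastBit a,
    h.matched.contract_lastBit (h.flat 0) (h.flat 1) a, fun ρ b => ?_, h.numT_eq, h.numRootT_eq⟩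
  change r.map (appendQubit _ ρ) b b = _
  rw [h.map_apply, trace_mul_eq_submatrix (appendBit_injective a)]
  · congr 2
    ext ⟨x, u⟩ ⟨y, v⟩
    simp [appendBit, appendQubit]
  · rintro ⟨x, u⟩ ⟨y, v⟩ hxy
    rw [mem_range_appendBit, mem_range_appendBit] at hxy
    simp only [kronecker_apply, appendQubit, LinearMap.coe_mk, AddHom.coe_mk, of_apply]
    rcases hxy with hxy | hxy
    · rw [Matrix.single_apply_of_row_ne (Ne.symm hxy)]; simp
    · rw [Matrix.single_apply_of_col_ne _ _ (Ne.symm hxy)]; simp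

/-- A resource state is not contracted into the operators, which would destroy flatness. Its qubit
is only relabelled as a resource qubit, and its state enters through `resourceState`. -/
lemma Run.Represents.resource {n k : ℕ} {r : Run (n + 1)} {res : Fin k → Resource}
    {D : Fin 2 → Matrix (Labels (n + 1) k) (Labels (n + 1) k) ℂ} (h : r.Represents res D)
    (s : Resource) : ((r.after (appendQubit (pureState s.ket))).count s).Represents
      (Fin.cons s res : Fin (k + 1) → Resource)
      fun b => (D b).submatrix (moveLast n k) (moveLast n k) := by
  refine ⟨fun b => (h.flat b).submatrix_equiv _ submatrix_moveLast_mem,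
    h.matched.submatrix_equiv _ submatrix_moveLast_mem, fun ρ b => ?_, ?_, ?_⟩
  · have : ((r.after (appendQubit (pureState s.ket))).count s).map ρ
        = r.map (appendQubit (pureState s.ket) ρ) := by cases s <;> rfl
    rw [this, h.map_apply, trace_mul_eq_submatrix (moveLast n k).injective]
    · congr 2
      ext ⟨x, u⟩ ⟨y, v⟩
      simp [moveLast, appendQubit, resourceState, tensorProd, Fin.prod_univ_succ, Fin.tail,
        mul_assoc]
    · simp [(moveLast n k).surjective.range_eq]
  · rw [Fin.sum_univ_succ]
    have := h.numT_eq
    cases s <;> simp [Run.count, Run.after, Resource.countT, this, add_comm]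
  · rw [Fin.sum_univ_succ]
    have := h.numRootT_eq
    cases s <;> simp [Run.count, Run.after, Resource.countRootT, this, add_comm]

lemma pureState_ketZero : pureState ketZero = Matrix.single 0 0 1 := by
  ext i j; fin_cases i <;> fin_cases j <;> simp [pureState, ketZero, vecMulVec_apply]

lemma Protocol.exists_represents {n : ℕ} (π : Protocol n) :
    ∀ r ∈ π.runs, ∃ (k : ℕ) (res : Fin k → Resource)
      (D : Fin 2 → Matrix (Labels n k) (Labels n k) ℂ), r.Represents res D := by
  induction π with
  | output j =>
    intro r hr
    obtain rfl : r = _ := by simpa [Protocol.runs] using hr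
    obtain ⟨D, hD⟩ := Run.Represents.output j
    exact ⟨0, _, D, hD⟩
  | clifford U hU next ih =>
    intro r hr
    simp only [Protocol.runs, List.mem_map] at hr
    obtain ⟨r, hr, rfl⟩ := hr
    obtain ⟨k, res, D, hD⟩ := ih r hr
    obtain ⟨D', hD'⟩ := hD.clifford hU
    exact ⟨k, res, D', hD'⟩
  | ancilla next ih =>
    intro r hr
    simp only [Protocol.runs, List.mem_map] at hr
    obtain ⟨r, hr, rfl⟩ := hr
    obtain ⟨k, res, D, hD⟩ := ih r hr
    rw [pureState_ketZero]
    exact ⟨k, res, _, hD.appendBasis 0⟩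
  | resource s next ih =>
    intro r hr
    simp only [Protocol.runs, List.mem_map] at hr
    obtain ⟨r, hr, rfl⟩ := hr
    obtain ⟨k, res, D, hD⟩ := ih r hr
    exact ⟨k + 1, _, _, hD.resource s⟩
  | measure P onPlus onMinus ih ih' =>
    intro r hr
    simp only [Protocol.runs, List.mem_append, List.mem_map] at hr
    rcases hr with ⟨r, hr, rfl⟩ | ⟨r, hr, rfl⟩
    · obtain ⟨k, res, D, hD⟩ := ih r hr
      obtain ⟨D', hD'⟩ := hD.measure P true
      exact ⟨k, res, D', hD'⟩
    · obtain ⟨k, res, D, hD⟩ := ih' r hr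
      obtain ⟨D', hD'⟩ := hD.measure P false
      exact ⟨k, res, D', hD'⟩
  | coin p onHeads onTails ih ih' =>
    intro r hr
    simp only [Protocol.runs, List.mem_append, List.mem_map] at hr
    rcases hr with ⟨r, hr, rfl⟩ | ⟨r, hr, rfl⟩
    · obtain ⟨k, res, D, hD⟩ := ih r hr
      exact ⟨k, res, _, hD.coin p.2.1⟩
    · obtain ⟨k, res, D, hD⟩ := ih' r hr
      exact ⟨k, res, _, hD.coin (sub_nonneg.2 p.2.2)⟩

end Runs

/-! ### The norm from the quartic field of `2 cos (π / 8)` to the rationals -/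

section Norm

open Polynomial

lemma exists_cubic_eq_aeval (p : ℤ[X]) : ∃ c₀ c₁ c₂ c₃ : ℤ, ∀ x : ℝ, x ^ 4 = 4 * x ^ 2 - 2 →
    aeval x p = c₀ + c₁ * x + c₂ * x ^ 2 + c₃ * x ^ 3 := by
  induction p using Polynomial.induction_on with
  | C a => exact ⟨a, 0, 0, 0, fun x _ => by simp⟩
  | add p q hp hq =>
    obtain ⟨c₀, c₁, c₂, c₃, h⟩ := hp
    obtain ⟨d₀, d₁, d₂, d₃, h'⟩ := hq
    refine ⟨c₀ + d₀, c₁ + d₁, c₂ + d₂, c₃ + d₃, fun x hx => ?_⟩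
    rw [map_add, h x hx, h' x hx]
    push_cast
    ring
  | monomial n a h =>
    obtain ⟨c₀, c₁, c₂, c₃, h⟩ := h
    -- Multiplication of the cubic by `x`, with `c₃ x⁴` reduced to `4 c₃ x² - 2 c₃`.
    refine ⟨-2 * c₃, c₀, c₁ + 4 * c₃, c₂, fun x hx => ?_⟩
    rw [pow_succ, ← mul_assoc, map_mul, h x hx, aeval_X]
    push_cast
    linear_combination (c₃ : ℝ) * hx

lemma eq_zero_of_sq_eq_two_mul_sq {a b : ℤ} (h : a ^ 2 = 2 * b ^ 2) : a = 0 ∧ b = 0 := by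
  by_cases hb : b = 0
  · subst hb; simpa using h
  · exfalso
    refine irrational_sqrt_two ⟨|(a : ℚ) / b|, ?_⟩
    have hb' : (b : ℝ) ≠ 0 := by exact_mod_cast hb
    have h' : (a : ℝ) ^ 2 = 2 * (b : ℝ) ^ 2 := by exact_mod_cast h
    rw [Rat.cast_abs, ← Real.sqrt_sq_eq_abs]
    push_cast
    rw [div_pow, h', mul_div_assoc, div_self (pow_ne_zero 2 hb'), mul_one]

/-- The product of the values of an integral polynomial at the roots of `X⁴ - 4X² + 2` is an
integer, which vanishes only if all of them vanish. -/
lemma one_le_abs_prod_aeval (p : ℤ[X]) {x y : ℝ} (hx : x ^ 2 = 2 + √2) (hy : y ^ 2 = 2 - √2)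
    (hp : aeval x p ≠ 0) : 1 ≤ |aeval x p * aeval (-x) p * (aeval y p * aeval (-y) p)| := by
  obtain ⟨c₀, c₁, c₂, c₃, h⟩ := exists_cubic_eq_aeval p
  have h2 : √2 ^ 2 = 2 := Real.sq_sqrt (by norm_num)
  have hx4 : x ^ 4 = 4 * x ^ 2 - 2 := by
    linear_combination (x ^ 2 - 2 + √2) * hx + h2
  have hy4 : y ^ 4 = 4 * y ^ 2 - 2 := by
    linear_combination (y ^ 2 - 2 - √2) * hy + h2
  rw [h x hx4] at hp
  rw [h x hx4, h (-x) (by rw [neg_pow_two, ← hx4]; ring), h y hy4,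
    h (-y) (by rw [neg_pow_two, ← hy4]; ring)]
  -- The norm is taken in two stages through `ℚ(√2)`. Since `x² = 2 + √2`, the even part is `c₀ + c₂
  -- x² = u₀ + c₂ √2` and the odd part is `x (v₀ + c₃ √2)`. Hence `A + B √2 = (u₀ + c₂ √2)² - (2 +
  -- √2) (v₀ + c₃ √2)²`.
  set u₀ : ℤ := c₀ + 2 * c₂ with hu₀
  set v₀ : ℤ := c₁ + 2 * c₃ with hv₀
  set A : ℤ := u₀ ^ 2 + 2 * c₂ ^ 2 - 2 * (v₀ ^ 2 + 2 * c₃ ^ 2) - 4 * v₀ * c₃ with hA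
  set B : ℤ := 2 * u₀ * c₂ - 4 * v₀ * c₃ - (v₀ ^ 2 + 2 * c₃ ^ 2) with hB
  have e1 : ((c₀ : ℝ) + c₁ * x + c₂ * x ^ 2 + c₃ * x ^ 3) *
      (c₀ + c₁ * -x + c₂ * (-x) ^ 2 + c₃ * (-x) ^ 3) = A + B * √2 := by
    have : ((c₀ : ℝ) + c₁ * x + c₂ * x ^ 2 + c₃ * x ^ 3) *
      (c₀ + c₁ * -x + c₂ * (-x) ^ 2 + c₃ * (-x) ^ 3)
        = (c₀ + c₂ * x ^ 2) ^ 2 - x ^ 2 * (c₁ + c₃ * x ^ 2) ^ 2 := by ring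
    rw [this, hx, hA, hB, hu₀, hv₀]
    push_cast
    linear_combination ((c₂ : ℝ) ^ 2 - 2 * c₃ * (c₁ + 2 * c₃) - (2 + √2) * c₃ ^ 2) * h2
  have e2 : ((c₀ : ℝ) + c₁ * y + c₂ * y ^ 2 + c₃ * y ^ 3) *
      (c₀ + c₁ * -y + c₂ * (-y) ^ 2 + c₃ * (-y) ^ 3) = A - B * √2 := by
    have : ((c₀ : ℝ) + c₁ * y + c₂ * y ^ 2 + c₃ * y ^ 3) *
      (c₀ + c₁ * -y + c₂ * (-y) ^ 2 + c₃ * (-y) ^ 3)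
        = (c₀ + c₂ * y ^ 2) ^ 2 - y ^ 2 * (c₁ + c₃ * y ^ 2) ^ 2 := by ring
    rw [this, hy, hA, hB, hu₀, hv₀]
    push_cast
    linear_combination ((c₂ : ℝ) ^ 2 - 2 * c₃ * (c₁ + 2 * c₃) - (2 - √2) * c₃ ^ 2) * h2
  have e3 : ((A : ℝ) + B * √2) * (A - B * √2) = ((A ^ 2 - 2 * B ^ 2 : ℤ) : ℝ) := by
    push_cast
    linear_combination -(B : ℝ) ^ 2 * h2
  rw [e1, e2, e3, ← Int.cast_abs]
  have hne : A ^ 2 - 2 * B ^ 2 ≠ 0 := by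
    intro h0
    obtain ⟨hA0, hB0⟩ := eq_zero_of_sq_eq_two_mul_sq (sub_eq_zero.1 h0)
    -- If `A = B = 0`, then `(u₀ + c₂ √2)² = (2 + √2) (v₀ + c₃ √2)²`. Norms to `ℚ` give this
    -- equation, as `2 + √2` has norm `2`, and irrationality of `√2` applies again.
    have h3 : (u₀ ^ 2 - 2 * c₂ ^ 2) ^ 2 = 2 * (v₀ ^ 2 - 2 * c₃ ^ 2) ^ 2 := by
      rw [hA0] at hA
      rw [hB0] at hB
      linear_combination (-(u₀ ^ 2 + 2 * c₂ ^ 2) - (2 * (v₀ ^ 2 + 2 * c₃ ^ 2) + 4 * v₀ * c₃)) * hA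
        + 2 * (2 * u₀ * c₂ + (4 * v₀ * c₃ + (v₀ ^ 2 + 2 * c₃ ^ 2))) * hB
    obtain ⟨h4, h5⟩ := eq_zero_of_sq_eq_two_mul_sq h3
    obtain ⟨h6, h7⟩ := eq_zero_of_sq_eq_two_mul_sq (sub_eq_zero.1 h4)
    obtain ⟨h8, h9⟩ := eq_zero_of_sq_eq_two_mul_sq (sub_eq_zero.1 h5)
    have h10 : c₀ = 0 := by omega
    have h11 : c₁ = 0 := by omega
    exact hp (by simp [h10, h11, h7, h9])
  exact_mod_cast Int.one_le_abs hne

end Norm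

/-! ### Galois conjugates of the resource states -/

section Conjugates

/-- The Bloch coordinate `⟨X⟩` of the Galois conjugate of a resource state that belongs to a root
of `X⁴ - 4X² + 2`. The root `2 cos (π / 8)` gives the resource state itself. -/
def Resource.blochX : Resource → ℝ → ℝ
  | .T, x => (x ^ 2 - 2) / 2
  | .rootT, x => x / 2
  | .rootTCubed, x => (x ^ 3 - 3 * x) / 2

/-- The Bloch coordinate `⟨Y⟩` of a Galois conjugate of a resource state. -/
def Resource.blochY : Resource → ℝ → ℝ
  | .T, x => (x ^ 2 - 2) / 2
  | .rootT, x => (x ^ 3 - 3 * x) / 2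
  | .rootTCubed, x => x / 2

/-- Conjugation preserves the length of the Bloch vector. Hence the conjugates are pure states and
their expectation values obey the same positivity bounds. -/
lemma Resource.bloch_sq (r : Resource) {x : ℝ} (hx : x ^ 4 = 4 * x ^ 2 - 2) :
    r.blochX x ^ 2 + r.blochY x ^ 2 = 1 := by
  cases r <;> simp only [blochX, blochY]
  · linear_combination hx / 2
  · linear_combination (x ^ 2 - 2) / 4 * hx
  · linear_combination (x ^ 2 - 2) / 4 * hx

/-- A Galois conjugate of a resource state. -/
def Resource.conjKet (r : Resource) (x : ℝ) : Fin 2 → ℂ :=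
  ![1 / (√2 : ℂ), (r.blochX x + r.blochY x * Complex.I) / (√2 : ℂ)]

/-- The expectation values of the Pauli matrices in a Galois conjugate of a resource state. -/
def Resource.expect (r : Resource) (x : ℝ) : Pauli → ℝ
  | .I => 1
  | .X => r.blochX x
  | .Y => r.blochY x
  | .Z => 0

lemma two_cos_sq : (2 * Real.cos (Real.pi / 8)) ^ 2 = 2 + √2 := by
  rw [Real.cos_pi_div_eight, mul_pow, div_pow, Real.sq_sqrt (by positivity)]
  ring

lemma Resource.conjKet_cos (r : Resource) : r.conjKet (2 * Real.cos (Real.pi / 8)) = r.ket := by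
  have h3 : Real.cos (3 * Real.pi / 8) = 4 * Real.cos (Real.pi / 8) ^ 3
      - 3 * Real.cos (Real.pi / 8) := by
    rw [← Real.cos_three_mul]; ring_nf
  have h2 : Real.cos (Real.pi / 4) = 2 * Real.cos (Real.pi / 8) ^ 2 - 1 := by
    rw [← Real.cos_two_mul]; ring_nf
  have h2' : Real.sin (Real.pi / 4) = Real.cos (Real.pi / 4) := by
    rw [Real.sin_pi_div_four, Real.cos_pi_div_four]
  have h3' : Real.sin (Real.pi / 8) = Real.cos (3 * Real.pi / 8) := by
    rw [← Real.cos_pi_div_two_sub]; ring_nf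
  have h1' : Real.sin (3 * Real.pi / 8) = Real.cos (Real.pi / 8) := by
    rw [← Real.cos_pi_div_two_sub]; ring_nf
  have key : ∀ u v θ : ℝ, u = Real.cos θ → v = Real.sin θ →
      ![1 / (√2 : ℂ), (u + v * Complex.I) / (√2 : ℂ)] = phaseKet θ := by
    rintro u v θ rfl rfl
    rw [phaseKet, Complex.exp_mul_I, Complex.ofReal_cos, Complex.ofReal_sin]
  cases r <;> refine key _ _ _ ?_ ?_ <;> simp only [blochX, blochY]
  · rw [h2]; ring
  · rw [h2', h2]; ring
  · ring
  · rw [h3', h3]; ring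
  · rw [h3]; ring
  · rw [h1']; ring

instance : Fintype Pauli where
  elems := ⟨([Pauli.I, Pauli.X, Pauli.Y, Pauli.Z] : List Pauli), by simp⟩
  complete P := by cases P <;> simp

lemma Pauli.sum_univ {M : Type*} [AddCommMonoid M] (f : Pauli → M) :
    ∑ P, f P = f .I + f .X + f .Y + f .Z := by
  change (Multiset.map f ([.I, .X, .Y, .Z] : List Pauli)).sum = _
  simp [add_assoc]

lemma ofReal_sqrt_two_mul_self : (√2 : ℂ) * (√2 : ℂ) = 2 := by
  rw [← Complex.ofReal_mul, Real.mul_self_sqrt (by norm_num)]; simp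

lemma Resource.pureState_conjKet (r : Resource) {x : ℝ} (hx : x ^ 4 = 4 * x ^ 2 - 2) (a b : Fin 2) :
    pureState (r.conjKet x) a b = ∑ P : Pauli, (1 / 2 : ℂ) * (r.expect x P * P.toMatrix a b) := by
  have h := r.bloch_sq hx
  have h' : (r.blochX x : ℂ) ^ 2 + (r.blochY x : ℂ) ^ 2 = 1 := by exact_mod_cast h
  have h2 := ofReal_sqrt_two_mul_self
  have h0 : (√2 : ℂ) ≠ 0 := by intro h; rw [h] at h2; norm_num at h2
  rw [Pauli.sum_univ]
  have hd : ∀ z w : ℂ, z / (√2 : ℂ) * (w / (√2 : ℂ)) = 1 / 2 * (z * w) := by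
    intro z w; rw [div_mul_div_comm, h2]; ring
  fin_cases a <;> fin_cases b <;>
    simp only [pureState, conjKet, vecMulVec_apply, expect, Pauli.toMatrix, Pi.star_apply,
      Fin.zero_eta, Fin.mk_one, Fin.isValue, cons_val_zero, cons_val_one, of_apply, cons_val',
      cons_val_fin_one, star_div₀, RCLike.star_def, Complex.conj_ofReal, map_add, map_mul,
      Complex.conj_I, map_one, hd] <;> push_cast
  · ring
  · ring
  · ring
  · linear_combination 1 / 2 * h' - 1 / 2 * (r.blochY x : ℂ) ^ 2 * Complex.I_sq

/-- A Galois conjugate of the joint state of the resource qubits. -/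
def conjState {k : ℕ} (res : Fin k → Resource) (x : ℝ) : Op k :=
  tensorProd fun i => pureState ((res i).conjKet x)

lemma conjState_cos {k : ℕ} (res : Fin k → Resource) :
    conjState res (2 * Real.cos (Real.pi / 8)) = resourceState res := by
  simp_rw [conjState, Resource.conjKet_cos, resourceState]

lemma conjState_eq_sum {k : ℕ} (res : Fin k → Resource) {x : ℝ} (hx : x ^ 4 = 4 * x ^ 2 - 2) :
    conjState res x = (1 / 2 : ℂ) ^ k •
      ∑ Q : Fin k → Pauli, ((∏ i, (res i).expect x (Q i) : ℝ) : ℂ) • pauliString Q := by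
  ext a b
  simp only [conjState, tensorProd, of_apply, Resource.pureState_conjKet _ hx, Matrix.smul_apply,
    Matrix.sum_apply, pauliString, smul_eq_mul]
  rw [Finset.prod_univ_sum, Fintype.piFinset_univ, Finset.mul_sum]
  refine Finset.sum_congr rfl fun Q _ => ?_
  rw [Finset.prod_mul_distrib, Finset.prod_mul_distrib]
  simp

/-- The joint vector of Galois conjugates of resource states. -/
def conjVec {k : ℕ} (res : Fin k → Resource) (x : ℝ) : (Fin k → Fin 2) → ℂ :=
  fun a => ∏ i, (res i).conjKet x (a i)

lemma conjState_eq_vecMulVec {k : ℕ} (res : Fin k → Resource) (x : ℝ) :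
    conjState res x = vecMulVec (conjVec res x) (star (conjVec res x)) := by
  ext a b
  simp [conjState, tensorProd, pureState, vecMulVec_apply, conjVec, Finset.prod_mul_distrib]

lemma star_conjVec_dotProduct {k : ℕ} (res : Fin k → Resource) (x y : ℝ) :
    star (conjVec res x) ⬝ᵥ conjVec res y
      = ∏ i, (star ((res i).conjKet x) ⬝ᵥ (res i).conjKet y) := by
  simp only [dotProduct, conjVec, Finset.prod_univ_sum, Fintype.piFinset_univ, Pi.star_apply,
    star_prod, Finset.prod_mul_distrib]

lemma Resource.star_conjKet_dotProduct (r : Resource) (x y : ℝ) :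
    star (r.conjKet x) ⬝ᵥ r.conjKet y = 1 / 2 * (1 + (r.blochX x - r.blochY x * Complex.I) *
      (r.blochX y + r.blochY y * Complex.I)) := by
  have h2 := ofReal_sqrt_two_mul_self
  have hd : ∀ z w : ℂ, z / (√2 : ℂ) * (w / (√2 : ℂ)) = 1 / 2 * (z * w) := by
    intro z w; rw [div_mul_div_comm, h2]; ring
  simp only [dotProduct, Fin.sum_univ_two, Pi.star_apply, conjKet, cons_val_zero, cons_val_one,
    map_div₀, RCLike.star_def, Complex.conj_ofReal, map_add, map_mul, Complex.conj_I, map_one, hd]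
  ring

lemma star_conjVec_dotProduct_self {k : ℕ} (res : Fin k → Resource) {x : ℝ}
    (hx : x ^ 4 = 4 * x ^ 2 - 2) : star (conjVec res x) ⬝ᵥ conjVec res x = 1 := by
  rw [star_conjVec_dotProduct]
  refine Finset.prod_eq_one fun i _ => ?_
  have h : (((res i).blochX x : ℂ)) ^ 2 + ((res i).blochY x : ℂ) ^ 2 = 1 := by
    exact_mod_cast (res i).bloch_sq hx
  rw [Resource.star_conjKet_dotProduct]
  linear_combination 1 / 2 * h - 1 / 2 * ((res i).blochY x : ℂ) ^ 2 * Complex.I_sq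

/-- The Bloch coordinates of `|√T⟩` and `|√T³⟩` are odd in `x`, so `x ↦ -x` sends such a state to
the antipodal one, and one vanishing factor makes the whole product vanish. For `|T⟩` they are even,
which is why one other resource state is required. -/
lemma star_conjVec_dotProduct_neg {k : ℕ} (res : Fin k → Resource) {x : ℝ}
    (hx : x ^ 4 = 4 * x ^ 2 - 2) {i : Fin k} (hi : res i ≠ .T) :
    star (conjVec res x) ⬝ᵥ conjVec res (-x) = 0 := by
  rw [star_conjVec_dotProduct]
  refine Finset.prod_eq_zero (Finset.mem_univ i) ?_
  have h : (((res i).blochX x : ℂ)) ^ 2 + ((res i).blochY x : ℂ) ^ 2 = 1 := by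
    exact_mod_cast (res i).bloch_sq hx
  have h1 : (res i).blochX (-x) = -(res i).blochX x ∧ (res i).blochY (-x) = -(res i).blochY x := by
    revert hi
    cases res i <;> simp only [Resource.blochX, Resource.blochY] <;> intro hi
    · exact absurd rfl hi
    · constructor <;> ring
    · constructor <;> ring
  rw [Resource.star_conjKet_dotProduct, h1.1, h1.2]
  push_cast
  linear_combination -1 / 2 * h + 1 / 2 * ((res i).blochY x : ℂ) ^ 2 * Complex.I_sq

end Conjugates

/-! ### Lower bound for nonzero expectation values of flat operators -/

section FlatBound

open Polynomial

/-- The factor that makes the Pauli expectation values of a resource state algebraic integers. -/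
def Resource.scale : Resource → ℝ → ℝ
  | .T, x => x ^ 2 - 2
  | .rootT, x => 4 * x - x ^ 3
  | .rootTCubed, x => 4 * x - x ^ 3

/-- The scaled Pauli expectation values of a resource state as integral polynomials. -/
def Resource.expectPoly : Resource → Pauli → ℤ[X]
  | .T, .I => X ^ 2 - 2
  | .T, .X => 1
  | .T, .Y => 1
  | .T, .Z => 0
  | .rootT, .I => 4 * X - X ^ 3
  | .rootT, .X => 1
  | .rootT, .Y => X ^ 2 - 3
  | .rootT, .Z => 0
  | .rootTCubed, .I => 4 * X - X ^ 3
  | .rootTCubed, .X => X ^ 2 - 3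
  | .rootTCubed, .Y => 1
  | .rootTCubed, .Z => 0

/-- The scale is chosen to cancel the denominators: `x² - 2` is a square root of `2`, and `4x - x³ =
2 / x`. -/
lemma Resource.aeval_expectPoly (r : Resource) (P : Pauli) {x : ℝ} (hx : x ^ 4 = 4 * x ^ 2 - 2) :
    aeval x (r.expectPoly P) = r.scale x * r.expect x P := by
  cases r <;> cases P <;>
    simp only [expectPoly, scale, expect, blochX, blochY, map_sub, map_mul, map_pow, map_one,
      map_zero, aeval_X, map_ofNat, mul_one, mul_zero]
  · linear_combination -hx / 2
  · linear_combination -hx / 2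
  · linear_combination hx / 2
  · linear_combination (x ^ 2 - 3) / 2 * hx
  · linear_combination (x ^ 2 - 3) / 2 * hx
  · linear_combination hx / 2

/-- These are the field norms: `√2` has norm `4`, and `2 / x` has norm `16 / 2 = 8`. The difference
between the two is what makes a copy of `|T⟩` cheaper. -/
lemma Resource.abs_prod_scale (r : Resource) {x y : ℝ} (hx : x ^ 2 = 2 + √2) (hy : y ^ 2 = 2 - √2) :
    |r.scale x * r.scale (-x) * (r.scale y * r.scale (-y))| = 4 ^ r.countT * 8 ^ r.countRootT := by
  have h2 : √2 ^ 2 = 2 := Real.sq_sqrt (by norm_num)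
  have h4 : √2 ^ 4 = 4 := by linear_combination (√2 ^ 2 + 2) * h2
  have h8 : (4 * x - x ^ 3) * (4 * -x - (-x) ^ 3) * ((4 * y - y ^ 3) * (4 * -y - (-y) ^ 3)) = 8 := by
    calc (4 * x - x ^ 3) * (4 * -x - (-x) ^ 3) * ((4 * y - y ^ 3) * (4 * -y - (-y) ^ 3))
        = (x ^ 2 * (4 - x ^ 2) ^ 2) * (y ^ 2 * (4 - y ^ 2) ^ 2) := by ring
      _ = (4 - √2 ^ 2) ^ 3 := by rw [hx, hy]; ring
      _ = 8 := by rw [h2]; norm_num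
  cases r <;> simp only [scale, countT, countRootT]
  · rw [neg_sq, neg_sq, hx, hy]
    ring_nf
    rw [h4]; norm_num
  · rw [h8]; norm_num
  · rw [h8]; norm_num

variable {k : ℕ} {F : Op k}

/-- The expectation value of an operator in a Galois conjugate of the state of the resource
qubits. -/
def conjValue (F : Op k) (res : Fin k → Resource) (x : ℝ) : ℝ := (F * conjState res x).trace.re

lemma trace_mul_nonneg {ι : Type*} [Fintype ι] [DecidableEq ι] {A B : Matrix ι ι ℂ}
    (hA : A.PosSemidef) (hB : B.PosSemidef) : 0 ≤ (A * B).trace := by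
  obtain ⟨C, rfl⟩ := exists_eq_conjTranspose_mul_self hA
  rw [Matrix.mul_assoc, trace_mul_comm]
  exact (hB.mul_mul_conjTranspose_same C).trace_nonneg

lemma conjValue_nonneg (hF : F.PosSemidef) (res : Fin k → Resource) (x : ℝ) :
    0 ≤ conjValue F res x := by
  rw [conjValue, conjState_eq_vecMulVec]
  exact (Complex.le_def.1 (trace_mul_nonneg hF (posSemidef_vecMulVec_self_star _))).1

lemma IsHermitian.posSemidef_of_mul_self {ι : Type*} [Fintype ι] {A : Matrix ι ι ℂ}
    (hA : A.IsHermitian) (h : A * A = A) : A.PosSemidef := by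
  have := posSemidef_conjTranspose_mul_self A
  rwa [hA.eq, h] at this

lemma vecMulVec_star_isHermitian {ι : Type*} (v : ι → ℂ) : (vecMulVec v (star v)).IsHermitian := by
  ext i j; simp [vecMulVec_apply, mul_comm]

lemma conjState_mul_self (res : Fin k → Resource) {x : ℝ} (hx : x ^ 4 = 4 * x ^ 2 - 2) :
    conjState res x * conjState res x = conjState res x := by
  rw [conjState_eq_vecMulVec, vecMulVec_mul_vecMulVec, star_conjVec_dotProduct_self res hx, one_smul]

lemma conjState_isHermitian (res : Fin k → Resource) (x : ℝ) :
    (conjState res x).IsHermitian := by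
  rw [conjState_eq_vecMulVec]; exact vecMulVec_star_isHermitian _

lemma conjValue_le (hF : F.PosSemidef) (res : Fin k → Resource) {x : ℝ}
    (hx : x ^ 4 = 4 * x ^ 2 - 2) : conjValue F res x ≤ F.trace.re := by
  have h : (1 - conjState res x).PosSemidef := by
    refine IsHermitian.posSemidef_of_mul_self
      (isHermitian_one.sub (conjState_isHermitian res x)) ?_
    rw [sub_mul, mul_sub, mul_sub, conjState_mul_self res hx]; simp
  have := (Complex.le_def.1 (trace_mul_nonneg hF h)).1
  rw [mul_sub, Matrix.mul_one, trace_sub, Complex.sub_re, Complex.zero_re] at this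
  rw [conjValue]; linarith

lemma conjValue_add_neg_le (hF : F.PosSemidef) (res : Fin k → Resource) {x : ℝ}
    (hx : x ^ 4 = 4 * x ^ 2 - 2) {i : Fin k} (hi : res i ≠ .T) :
    conjValue F res x + conjValue F res (-x) ≤ F.trace.re := by
  have hx' : (-x) ^ 4 = 4 * (-x) ^ 2 - 2 := by rw [neg_sq, ← hx]; ring
  have h0 : conjState res x * conjState res (-x) = 0 := by
    rw [conjState_eq_vecMulVec, conjState_eq_vecMulVec, vecMulVec_mul_vecMulVec,
      star_conjVec_dotProduct_neg res hx hi, zero_smul, vecMulVec_zero]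
  have h0' : conjState res (-x) * conjState res x = 0 := by
    have := congrArg conjTranspose h0
    rwa [conjTranspose_mul, (conjState_isHermitian res x).eq, (conjState_isHermitian res (-x)).eq,
      conjTranspose_zero] at this
  have h : (1 - conjState res x - conjState res (-x)).PosSemidef := by
    refine IsHermitian.posSemidef_of_mul_self
      ((isHermitian_one.sub (conjState_isHermitian res x)).sub (conjState_isHermitian res (-x))) ?_
    simp only [sub_mul, mul_sub, conjState_mul_self res hx, conjState_mul_self res hx', h0, h0',
      Matrix.one_mul, Matrix.mul_one]
    abel
  have := (Complex.le_def.1 (trace_mul_nonneg hF h)).1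
  rw [mul_sub, mul_sub, Matrix.mul_one, trace_sub, trace_sub, Complex.sub_re, Complex.sub_re,
    Complex.zero_re] at this
  rw [conjValue, conjValue]; linarith

/-- In the Pauli expansion of the state, flatness turns every coefficient of `F` into `0` or `±tr
F`. After division by the trace only integer combinations of products of Bloch coordinates remain,
with the same integers for all conjugates. -/
lemma Flat.exists_poly (hF : Flat (Set.range (pauliString : (Fin k → Pauli) → Op k)) F)
    (res : Fin k → Resource) : ∃ p : ℤ[X], ∀ x : ℝ, x ^ 4 = 4 * x ^ 2 - 2 →
      aeval x p * F.trace.re = (∏ i, (res i).scale x) * (2 ^ k * conjValue F res x) := by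
  have htr : F.trace = (F.trace.re : ℂ) := by
    have := (Complex.le_def.1 hF.posSemidef.trace_nonneg).2
    apply Complex.ext <;> simp [← this]
  have hε : ∀ Q : Fin k → Pauli, ∃ ε : ℤ, (pauliString Q * F).trace = (ε * F.trace.re : ℝ) := by
    intro Q
    rcases hF.trace_mul _ ⟨Q, rfl⟩ with h | h | h
    · exact ⟨0, by simp [h]⟩
    · exact ⟨1, by rw [h]; simpa using htr⟩
    · exact ⟨-1, by rw [h]; simpa using htr⟩
  choose ε hε using hε
  refine ⟨∑ Q, C (ε Q) * ∏ i, (res i).expectPoly (Q i), fun x hx => ?_⟩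
  have h1 : (F * conjState res x).trace = (((1 / 2) ^ k *
      ∑ Q : Fin k → Pauli, (∏ i, (res i).expect x (Q i)) * (ε Q * F.trace.re) : ℝ) : ℂ) := by
    rw [conjState_eq_sum res hx, Matrix.mul_smul, trace_smul, Matrix.mul_sum, trace_sum]
    push_cast
    rw [smul_eq_mul]
    congr 1
    refine Finset.sum_congr rfl fun Q _ => ?_
    rw [Matrix.mul_smul, trace_smul, trace_mul_comm, hε Q]
    push_cast
    rfl
  have h2 : conjValue F res x = (1 / 2) ^ k *
      ∑ Q : Fin k → Pauli, (∏ i, (res i).expect x (Q i)) * (ε Q * F.trace.re) := by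
    rw [conjValue, h1, Complex.ofReal_re]
  rw [h2, ← mul_assoc (2 ^ k : ℝ), ← mul_pow, show (2 : ℝ) * (1 / 2) = 1 by norm_num, one_pow, one_mul,
    map_sum, Finset.sum_mul, Finset.mul_sum]
  refine Finset.sum_congr rfl fun Q _ => ?_
  rw [map_mul, map_prod, Finset.prod_congr rfl fun i _ => (res i).aeval_expectPoly (Q i) hx,
    Finset.prod_mul_distrib]
  simp
  ring

lemma abs_prod_prod_scale (res : Fin k → Resource) {x y : ℝ} (hx : x ^ 2 = 2 + √2)
    (hy : y ^ 2 = 2 - √2) :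
    |(∏ i, (res i).scale x) * (∏ i, (res i).scale (-x)) *
      ((∏ i, (res i).scale y) * ∏ i, (res i).scale (-y))|
      = 4 ^ (∑ i, (res i).countT) * 8 ^ (∑ i, (res i).countRootT) := by
  simp only [← Finset.prod_mul_distrib, Finset.abs_prod,
    fun i => (res i).abs_prod_scale hx hy]
  rw [Finset.prod_mul_distrib, Finset.prod_pow_eq_pow_sum, Finset.prod_pow_eq_pow_sum]

lemma sum_counts (res : Fin k → Resource) :
    ∑ i, (res i).countT + ∑ i, (res i).countRootT = k := by
  rw [← Finset.sum_add_distrib, Finset.sum_congr rfl (g := fun _ => 1)]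
  · simp
  · intro i _; cases res i <;> rfl

lemma pow_four_le_of_scaled {t K a₁ a₂ a₃ a₄ s₁ s₂ s₃ s₄ v₁ v₂ v₃ v₄ : ℝ}
    (h₁ : 0 ≤ v₁) (h₂ : 0 ≤ v₂) (h₃ : 0 ≤ v₃) (h₄ : 0 ≤ v₄) (e₁ : a₁ * t = s₁ * (K * v₁))
    (e₂ : a₂ * t = s₂ * (K * v₂)) (e₃ : a₃ * t = s₃ * (K * v₃)) (e₄ : a₄ * t = s₄ * (K * v₄))
    (h : 1 ≤ |a₁ * a₂ * (a₃ * a₄)|) :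
    t ^ 4 ≤ |s₁ * s₂ * (s₃ * s₄)| * K ^ 4 * (v₁ * v₂ * (v₃ * v₄)) := by
  have ht4 : |t ^ 4| = t ^ 4 := abs_of_nonneg (by positivity)
  have hKv : |K ^ 4 * (v₁ * v₂ * (v₃ * v₄))| = K ^ 4 * (v₁ * v₂ * (v₃ * v₄)) :=
    abs_of_nonneg (by positivity)
  calc t ^ 4 ≤ |t ^ 4| * |a₁ * a₂ * (a₃ * a₄)| := by
        rw [ht4]; exact le_mul_of_one_le_right (by positivity) h
    _ = |(a₁ * t) * (a₂ * t) * ((a₃ * t) * (a₄ * t))| := by rw [← abs_mul]; congr 1; ring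
    _ = |(s₁ * s₂ * (s₃ * s₄)) * (K ^ 4 * (v₁ * v₂ * (v₃ * v₄)))| := by
        rw [e₁, e₂, e₃, e₄]; congr 1; ring
    _ = _ := by rw [abs_mul, hKv]; ring

/-- Orthogonality of a pair of conjugates bounds `v₃ + v₄`, rather than each summand, by `t`; then
`v₃ v₄ ≤ t² / 4`, and this is the source of the factor `4`. -/
lemma le_of_orthogonal {t Z v₁ v₂ v₃ v₄ : ℝ} (ht : 0 < t) (hZ : 0 ≤ Z) (h₁ : 0 ≤ v₁)
    (h₃ : 0 ≤ v₃) (h₄ : 0 ≤ v₄) (h₂' : v₂ ≤ t) (h : v₃ + v₄ ≤ t)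
    (key : t ^ 4 ≤ Z * (v₁ * v₂ * (v₃ * v₄))) : 4 * t ≤ Z * v₁ := by
  have hprod : 4 * (v₃ * v₄) ≤ t ^ 2 := by nlinarith [sq_nonneg (v₃ - v₄)]
  refine le_of_mul_le_mul_right (a := t ^ 3) ?_ (by positivity)
  calc 4 * t * t ^ 3 = 4 * t ^ 4 := by ring
    _ ≤ 4 * (Z * (v₁ * v₂ * (v₃ * v₄))) := mul_le_mul_of_nonneg_left key (by norm_num)
    _ = (Z * v₁) * (v₂ * (4 * (v₃ * v₄))) := by ring
    _ ≤ (Z * v₁) * (t * t ^ 2) :=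
        mul_le_mul_of_nonneg_left (mul_le_mul h₂' hprod (by positivity) ht.le) (by positivity)
    _ = _ := by ring

lemma le_of_conj_eq {t Z v₁ v₃ : ℝ} (ht : 0 < t) (hZ : 0 ≤ Z) (h₁ : 0 ≤ v₁) (h₃ : 0 ≤ v₃)
    (h : v₃ ≤ t) (key : t ^ 4 ≤ (Z * (v₁ * v₃)) ^ 2) : t ≤ Z * v₁ := by
  have h' : t ^ 2 ≤ Z * (v₁ * v₃) :=
    le_of_sq_le_sq (by calc (t ^ 2) ^ 2 = t ^ 4 := by ring
                         _ ≤ _ := key) (by positivity)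
  refine le_of_mul_le_mul_right (a := t) ?_ ht
  calc t * t = t ^ 2 := by ring
    _ ≤ Z * (v₁ * v₃) := h'
    _ = (Z * v₁) * v₃ := by ring
    _ ≤ (Z * v₁) * t := mul_le_mul_of_nonneg_left h (by positivity)

/-- A nonzero expectation value of a flat operator in the state of the resource qubits is bounded
from below. -/
lemma Flat.le_trace (hF : Flat (Set.range (pauliString : (Fin k → Pauli) → Op k)) F)
    (res : Fin k → Resource) (hk : k ≠ 0)
    (h0 : conjValue F res (2 * Real.cos (Real.pi / 8)) ≠ 0) :
    4 * F.trace.re ≤ 64 ^ (∑ i, (res i).countT) * 128 ^ (∑ i, (res i).countRootT) *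
      conjValue F res (2 * Real.cos (Real.pi / 8)) := by
  set x := 2 * Real.cos (Real.pi / 8)
  set y := 2 * Real.sin (Real.pi / 8)
  set M := ∑ i, (res i).countT
  set N := ∑ i, (res i).countRootT
  have hMN : M + N = k := sum_counts res
  have h2 : √2 ^ 2 = 2 := Real.sq_sqrt (by norm_num)
  have hx : x ^ 2 = 2 + √2 := two_cos_sq
  have hy : y ^ 2 = 2 - √2 := by
    have := Real.sin_sq_add_cos_sq (Real.pi / 8)
    simp only [x, y] at hx ⊢
    linear_combination 4 * this - hx
  have hx4 : x ^ 4 = 4 * x ^ 2 - 2 := by linear_combination (x ^ 2 - 2 + √2) * hx + h2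
  have hy4 : y ^ 4 = 4 * y ^ 2 - 2 := by linear_combination (y ^ 2 - 2 - √2) * hy + h2
  have hx4' : (-x) ^ 4 = 4 * (-x) ^ 2 - 2 := by rw [neg_sq, ← hx4]; ring
  have hy4' : (-y) ^ 4 = 4 * (-y) ^ 2 - 2 := by rw [neg_sq, ← hy4]; ring
  have hpsd := hF.posSemidef
  obtain ⟨p, hp⟩ := hF.exists_poly res
  set t := F.trace.re
  have hvx := conjValue_nonneg hpsd res x
  have hvx' := conjValue_nonneg hpsd res (-x)
  have hvy := conjValue_nonneg hpsd res y
  have hvy' := conjValue_nonneg hpsd res (-y)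
  have hlx : conjValue F res x ≤ t := conjValue_le hpsd res hx4
  have hlx' : conjValue F res (-x) ≤ t := conjValue_le hpsd res hx4'
  have hly : conjValue F res y ≤ t := conjValue_le hpsd res hy4
  have ht : 0 < t := lt_of_lt_of_le (lt_of_le_of_ne hvx (Ne.symm h0)) hlx
  have hscale : |_| = (4 : ℝ) ^ M * 8 ^ N := abs_prod_prod_scale res hx hy
  have hcomm : ∀ j m : ℕ, ((2 : ℝ) ^ j) ^ m = 2 ^ (j * m) := fun j m => (pow_mul 2 j m).symm
  have h2k : (2 : ℝ) ^ k = 2 ^ M * 2 ^ N := by rw [← pow_add, hMN]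
  -- The scales do not vanish because their product over the four roots does not, so a zero of `p`
  -- at `x` would make the expectation value zero.
  have hpx : aeval x p ≠ 0 := by
    intro h
    have h1 := hp x hx4
    rw [h, zero_mul, eq_comm, mul_eq_zero, mul_eq_zero] at h1
    rcases h1 with h1 | h1 | h1
    · rw [h1] at hscale
      simp only [zero_mul, abs_zero] at hscale
      exact absurd hscale.symm (by positivity)
    · exact absurd h1 (by positivity)
    · exact h0 h1
  have h1 := one_le_abs_prod_aeval p hx hy hpx
  have key := pow_four_le_of_scaled hvx hvx' hvy hvy' (hp x hx4) (hp _ hx4')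
    (hp y hy4) (hp _ hy4') h1
  rw [hscale] at key
  by_cases hN : ∃ i, res i ≠ .T
  · obtain ⟨i, hi⟩ := hN
    have hsum := conjValue_add_neg_le hpsd res hy4 hi
    -- With `k = M + N`, the constant is `4 ^ M * 8 ^ N * (2 ^ k) ^ 4 = 64 ^ M * 128 ^ N`.
    refine (le_of_orthogonal ht (by positivity) hvx hvy hvy' hlx' hsum key).trans_eq ?_
    rw [h2k, show (64 : ℝ) = 2 ^ 6 by norm_num, show (128 : ℝ) = 2 ^ 7 by norm_num,
      show (8 : ℝ) = 2 ^ 3 by norm_num, show (4 : ℝ) = 2 ^ 2 by norm_num]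
    simp only [hcomm]
    ring
  · push Not at hN
    have hN0 : N = 0 := Finset.sum_eq_zero fun i _ => by rw [hN i]; rfl
    have hMk : M = k := by omega
    -- With copies of `|T⟩` only, the conjugates coincide in pairs, so a square root can be taken.
    -- The constant improves to `8 ^ k`, and `4 ≤ 8 ^ k` absorbs the factor that orthogonality would
    -- have given.
    have hneg : ∀ z, conjValue F res (-z) = conjValue F res z := by
      intro z
      have : ∀ i, (res i).conjKet (-z) = (res i).conjKet z := by
        intro i; rw [hN i]; simp [Resource.conjKet, Resource.blochX, Resource.blochY]
      simp only [conjValue, conjState, this]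
    rw [hneg, hneg, hN0, hMk, pow_zero, mul_one] at key
    rw [hN0, hMk, pow_zero, mul_one]
    have h4 : t ≤ 8 ^ k * conjValue F res x := by
      refine le_of_conj_eq ht (by positivity) hvx hvy hly (key.trans_eq ?_)
      rw [show (8 : ℝ) = 2 ^ 3 by norm_num, show (4 : ℝ) = 2 ^ 2 by norm_num]
      simp only [hcomm]
      ring
    have h6 : (4 : ℝ) ≤ 8 ^ k := by
      calc (4 : ℝ) ≤ 8 ^ 1 := by norm_num
        _ ≤ 8 ^ k := pow_le_pow_right₀ (by norm_num) (Nat.one_le_iff_ne_zero.2 hk)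
    calc 4 * t ≤ 8 ^ k * (8 ^ k * conjValue F res x) := by gcongr
      _ = 64 ^ k * conjValue F res x := by
        rw [show (64 : ℝ) = 8 * 8 by norm_num, mul_pow]; ring

end FlatBound

/-! ### Output probabilities of runs; positivity and trace preservation -/

section RunProperties

/-- The (unnormalized) probability of the output `b` of a run on the input `a`. -/
def Run.prob (r : Run 1) (a b : Fin 2) : ℝ := (r.map (singleRegister (Matrix.single a a 1)) b b).re

lemma singleRegister_single (a : Fin 2) :
    singleRegister (Matrix.single a a 1) = appendQubit (Matrix.single a a 1) (1 : Op 0) := by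
  ext x y
  change (Matrix.single a a 1 : Op₁) (x 0) (y 0) = (1 : Op 0) (fun i => x i.castSucc)
    (fun i => y i.castSucc) * (Matrix.single a a 1 : Op₁) (x 0) (y 0)
  rw [Subsingleton.elim (fun i : Fin 0 => x i.castSucc) (fun i => y i.castSucc),
    Matrix.one_apply_eq, one_mul]

/-- The resource labels as labels of an empty register together with resource qubits. -/
def emptyRegister (k : ℕ) : (Fin k → Fin 2) ≃ Labels 0 k := (Equiv.uniqueProd _ _).symm

lemma submatrix_emptyRegister_mem (k : ℕ) :
    ∀ P ∈ Set.range (pauliString : (Fin k → Pauli) → Op k),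
      P.submatrix (emptyRegister k).symm (emptyRegister k).symm ∈ registerPaulis 0 k := by
  rintro _ ⟨Q, rfl⟩
  refine ⟨Fin.elim0, Q, ?_⟩
  ext ⟨x, u⟩ ⟨y, v⟩
  simp [emptyRegister, pauliString]

/-- The basis state `a` at the input is treated as an ancilla that extends an empty register, so
only the resource qubits are left. -/
lemma Run.Represents.exists_flat {k : ℕ} {r : Run 1} {res : Fin k → Resource}
    {D : Fin 2 → Matrix (Labels 1 k) (Labels 1 k) ℂ} (h : r.Represents res D) (a : Fin 2) :
    ∃ F : Fin 2 → Op k, (∀ b, Flat (Set.range pauliString) (F b)) ∧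
      Matched (Set.range pauliString) (F 0) (F 1) ∧
      ∀ b, r.prob a b = conjValue (F b) res (2 * Real.cos (Real.pi / 8)) := by
  have h' := Run.Represents.appendBasis (n := 0) h a
  refine ⟨_, fun b => (h'.flat b).submatrix_equiv (emptyRegister k) (submatrix_emptyRegister_mem k),
    h'.matched.submatrix_equiv (emptyRegister k) (submatrix_emptyRegister_mem k), fun b => ?_⟩
  have h1 := h'.map_apply 1 b
  rw [Run.prob, singleRegister_single, conjValue, conjState_cos]
  change ((r.after (appendQubit (n := 0) (Matrix.single a a 1))).map 1 b b).re = _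
  rw [h1, trace_mul_eq_submatrix (emptyRegister k).injective]
  · congr 3
    ext u v
    simp [emptyRegister]
  · simp [(emptyRegister k).surjective.range_eq]

lemma Flat.trace_re_pos {k : ℕ} {F : Op k} {S : Set (Op k)} (hF : Flat S F)
    (res : Fin k → Resource) (h0 : conjValue F res (2 * Real.cos (Real.pi / 8)) ≠ 0) :
    0 < F.trace.re := by
  refine lt_of_lt_of_le (lt_of_le_of_ne (conjValue_nonneg hF.posSemidef _ _) h0.symm)
    (conjValue_le hF.posSemidef res ?_)
  have h2 : √2 ^ 2 = 2 := Real.sq_sqrt (by norm_num)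
  have hx := two_cos_sq
  linear_combination ((2 * Real.cos (Real.pi / 8)) ^ 2 - 2 + √2) * hx + h2

/-- The ratio of two nonzero output probabilities of a run without resource states is `1`, and in
general it is controlled by the number of resource states. -/
lemma Protocol.prob_ratio {π : Protocol 1} {r : Run 1} (hr : r ∈ π.runs) (a : Fin 2) {b c : Fin 2}
    (hb : r.prob a b ≠ 0) (hc : r.prob a c ≠ 0) :
    (r.numT = 0 → r.numRootT = 0 → r.prob a b = r.prob a c) ∧
      (r.numT + r.numRootT ≠ 0 →
        4 * r.prob a c ≤ 64 ^ r.numT * 128 ^ r.numRootT * r.prob a b) := by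
  obtain ⟨k, res, D, hD⟩ := π.exists_represents r hr
  obtain ⟨F, hF, hm, hp⟩ := hD.exists_flat a
  have hk := sum_counts res
  rw [← hD.numT_eq, ← hD.numRootT_eq] at hk
  rw [hp] at hb hc
  have htb := (hF b).trace_re_pos res hb
  have htc := (hF c).trace_re_pos res hc
  have htr : ∀ d e : Fin 2, 0 < (F d).trace.re → 0 < (F e).trace.re →
      (F d).trace.re = (F e).trace.re := by
    have key : 0 < (F 0).trace.re → 0 < (F 1).trace.re →
        (F 0).trace.re = (F 1).trace.re := by
      intro h0 h1
      rcases hm with h | h | h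
      · rw [h] at h0; simp at h0
      · rw [h] at h1; simp at h1
      -- The identity is itself a Pauli string, so matched operators have equal traces up to sign;
      -- positivity excludes the minus sign.
      · rcases h 1 ⟨fun _ => .I, pauliString_I⟩ with h | h <;>
          rw [Matrix.one_mul, Matrix.one_mul] at h
        · rw [h]
        · rw [h, Complex.neg_re] at h0; linarith
    intro d e hd he
    fin_cases d <;> fin_cases e
    · rfl
    · exact key hd he
    · exact (key he hd).symm
    · rfl
  have hbc := htr b c htb htc
  rw [hp, hp]
  constructor
  · intro h1 h2
    obtain rfl : k = 0 := by omega
    have h1 : ∀ G : Op 0, conjValue G res (2 * Real.cos (Real.pi / 8)) = G.trace.re := by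
      intro G
      have : conjState res (2 * Real.cos (Real.pi / 8)) = 1 := by
        ext x y
        rw [Subsingleton.elim x y, Matrix.one_apply_eq]
        simp [conjState, tensorProd]
      rw [conjValue, this, Matrix.mul_one]
    rw [h1, h1, hbc]
  · intro h
    rw [hD.numT_eq, hD.numRootT_eq]
    refine le_trans ?_ ((hF b).le_trace res (by omega) hb)
    rw [hbc]
    have h2 : √2 ^ 2 = 2 := Real.sq_sqrt (by norm_num)
    have := conjValue_le (hF c).posSemidef res (x := 2 * Real.cos (Real.pi / 8)) (by
      linear_combination ((2 * Real.cos (Real.pi / 8)) ^ 2 - 2 + √2) * two_cos_sq + h2)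
    linarith

/-- As a sum of principal submatrices, one for each setting of the discarded qubits, the partial
trace is visibly positive. -/
lemma keepQubit_eq_sum {n : ℕ} (j : Fin n) (ρ : Op n) :
    keepQubit j ρ = ∑ x : Fin n → Fin 2 with x j = 0,
      ρ.submatrix (Function.update x j) (Function.update x j) := by
  ext a b
  rw [Matrix.sum_apply]
  simp only [keepQubit, LinearMap.coe_mk, AddHom.coe_mk, of_apply, submatrix_apply]
  rw [← Finset.sum_filter]
  refine Finset.sum_nbij' (fun x => Function.update x j 0) (fun x => Function.update x j a)
    ?_ ?_ ?_ ?_ ?_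
  · simp
  · simp
  · intro x hx
    rw [Finset.mem_filter] at hx
    simp [← hx.2]
  · intro x hx
    rw [Finset.mem_filter] at hx
    simp [← hx.2]
  · intro x hx
    rw [Finset.mem_filter] at hx
    simp [← hx.2]

lemma appendQubit_eq_submatrix {n : ℕ} (σ : Op₁) (ρ : Op n) :
    appendQubit σ ρ = (ρ ⊗ₖ σ).submatrix (fun x => (fun i => x i.castSucc, x (Fin.last n)))
      (fun x => (fun i => x i.castSucc, x (Fin.last n))) := rfl

lemma appendQubit_posSemidef {n : ℕ} (ψ : Fin 2 → ℂ) {ρ : Op n} (hρ : ρ.PosSemidef) :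
    (appendQubit (pureState ψ) ρ).PosSemidef := by
  rw [appendQubit_eq_submatrix]
  exact (hρ.kronecker (posSemidef_vecMulVec_self_star ψ)).submatrix _

lemma Protocol.map_posSemidef {n : ℕ} (π : Protocol n) :
    ∀ r ∈ π.runs, ∀ ρ : Op n, ρ.PosSemidef → (r.map ρ).PosSemidef := by
  induction π with
  | output j =>
    intro r hr ρ hρ
    obtain rfl : r = _ := by simpa [Protocol.runs] using hr
    change (keepQubit j ρ).PosSemidef
    rw [keepQubit_eq_sum]
    exact posSemidef_sum _ fun x _ => hρ.submatrix _
  | clifford U hU next ih =>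
    intro r hr ρ hρ
    simp only [Protocol.runs, List.mem_map] at hr
    obtain ⟨r, hr, rfl⟩ := hr
    exact ih r hr _ (hρ.mul_mul_conjTranspose_same U)
  | ancilla next ih =>
    intro r hr ρ hρ
    simp only [Protocol.runs, List.mem_map] at hr
    obtain ⟨r, hr, rfl⟩ := hr
    exact ih r hr _ (appendQubit_posSemidef _ hρ)
  | resource s next ih =>
    intro r hr ρ hρ
    simp only [Protocol.runs, List.mem_map] at hr
    obtain ⟨r, hr, rfl⟩ := hr
    have : ((r.after (appendQubit (pureState s.ket))).count s).map ρ
        = r.map (appendQubit (pureState s.ket) ρ) := by cases s <;> rfl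
    rw [this]
    exact ih r hr _ (appendQubit_posSemidef _ hρ)
  | measure P onPlus onMinus ih ih' =>
    intro r hr ρ hρ
    simp only [Protocol.runs, List.mem_append, List.mem_map] at hr
    rcases hr with ⟨r, hr, rfl⟩ | ⟨r, hr, rfl⟩
    · exact ih r hr _ (hρ.mul_mul_conjTranspose_same _)
    · exact ih' r hr _ (hρ.mul_mul_conjTranspose_same _)
  | coin p onHeads onTails ih ih' =>
    intro r hr ρ hρ
    simp only [Protocol.runs, List.mem_append, List.mem_map] at hr
    rcases hr with ⟨r, hr, rfl⟩ | ⟨r, hr, rfl⟩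
    · exact ih r hr _ (hρ.smul (by exact_mod_cast p.2.1))
    · exact ih' r hr _ (hρ.smul (by exact_mod_cast sub_nonneg.2 p.2.2))

lemma trace_appendQubit {n : ℕ} (σ : Op₁) (ρ : Op n) :
    (appendQubit σ ρ).trace = ρ.trace * σ.trace := by
  rw [← trace_kronecker]
  exact Equiv.sum_comp ((Fin.snocEquiv fun _ => Fin 2).symm.trans (Equiv.prodComm _ _))
    fun z => (ρ ⊗ₖ σ) z z

lemma trace_keepQubit {n : ℕ} (j : Fin n) (ρ : Op n) : (keepQubit j ρ).trace = ρ.trace := by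
  simp only [trace, diag_apply, keepQubit, LinearMap.coe_mk, AddHom.coe_mk, of_apply]
  rw [Finset.sum_comm]
  refine Finset.sum_congr rfl fun x _ => ?_
  rw [Finset.sum_ite_eq]
  simp

lemma trace_pureState_phaseKet (θ : ℝ) : (pureState (phaseKet θ)).trace = 1 := by
  have h2 := ofReal_sqrt_two_mul_self
  have hd : ∀ z w : ℂ, z / (√2 : ℂ) * (w / (√2 : ℂ)) = 1 / 2 * (z * w) := by
    intro z w; rw [div_mul_div_comm, h2]; ring
  have he : Complex.exp (θ * Complex.I) * (starRingEnd ℂ) (Complex.exp (θ * Complex.I)) = 1 := by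
    rw [Complex.mul_conj, Complex.normSq_eq_norm_sq, Complex.norm_exp_ofReal_mul_I]; simp
  rw [pureState, trace_vecMulVec]
  simp only [dotProduct, Fin.sum_univ_two, Pi.star_apply, phaseKet, cons_val_zero, cons_val_one,
    RCLike.star_def, map_div₀, Complex.conj_ofReal, map_one, hd, he]
  norm_num

lemma pauliProj_conj_add {n : ℕ} (P : Fin n → Pauli) (ρ : Op n) :
    (pauliProj P true * ρ * (pauliProj P true)ᴴ).trace
      + (pauliProj P false * ρ * (pauliProj P false)ᴴ).trace = ρ.trace := by
  have h1 : pauliProj P true = eigenProj 1 (pauliString P) := by simp [pauliProj, eigenProj]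
  have h2 : pauliProj P false = eigenProj (-1) (pauliString P) := by
    simp [pauliProj, eigenProj, sub_eq_add_neg]
  have h3 : ∀ s : ℂ, s = 1 ∨ s = -1 → (eigenProj s (pauliString P) * ρ *
      (eigenProj s (pauliString P))ᴴ).trace = (eigenProj s (pauliString P) * ρ).trace := by
    intro s hs
    rw [(eigenProj_isHermitian hs (pauliString_isHermitian P)).eq, trace_mul_comm,
      ← Matrix.mul_assoc, eigenProj_mul_self hs (pauliString_mul_self P)]
  rw [h1, h2, h3 1 (.inl rfl), h3 (-1) (.inr rfl), ← trace_add, ← Matrix.add_mul]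
  have : eigenProj 1 (pauliString P) + eigenProj (-1) (pauliString P) = 1 := by
    rw [eigenProj, eigenProj, ← smul_add]
    rw [one_smul, neg_smul, one_smul, add_add_add_comm, add_neg_cancel, add_zero, ← two_smul ℂ,
      smul_smul]
    norm_num
  rw [this, Matrix.one_mul]

lemma Protocol.sum_trace {n : ℕ} (π : Protocol n) :
    ∀ ρ : Op n, (π.runs.map fun r => (r.map ρ).trace).sum = ρ.trace := by
  induction π with
  | output j => intro ρ; simp [Protocol.runs, trace_keepQubit]
  | clifford U hU next ih =>
    intro ρ
    simp only [Protocol.runs, List.map_map]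
    refine (ih (U * ρ * Uᴴ)).trans ?_
    rw [trace_mul_comm, ← Matrix.mul_assoc, ← star_eq_conjTranspose,
      Matrix.mem_unitaryGroup_iff'.1 hU.1, Matrix.one_mul]
  | ancilla next ih =>
    intro ρ
    simp only [Protocol.runs, List.map_map]
    refine (ih (appendQubit (pureState ketZero) ρ)).trans ?_
    rw [trace_appendQubit, pureState_ketZero]
    simp
  | resource s next ih =>
    intro ρ
    simp only [Protocol.runs, List.map_map]
    have : ∀ r : Run _, ((r.after (appendQubit (pureState s.ket))).count s).map ρ
        = r.map (appendQubit (pureState s.ket) ρ) := by intro r; cases s <;> rfl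
    simp only [Function.comp_def, this]
    rw [ih, trace_appendQubit]
    have : (pureState s.ket).trace = 1 := by cases s <;> exact trace_pureState_phaseKet _
    rw [this, mul_one]
  | measure P onPlus onMinus ih ih' =>
    intro ρ
    simp only [Protocol.runs, List.map_append, List.map_map, List.sum_append]
    rw [← pauliProj_conj_add P ρ, ← ih, ← ih']
    rfl
  | coin p onHeads onTails ih ih' =>
    intro ρ
    simp only [Protocol.runs, List.map_append, List.map_map, List.sum_append]
    have : ρ.trace = (((p : ℝ) : ℂ) • ρ).trace + (((1 - (p : ℝ) : ℝ) : ℂ) • ρ).trace := by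
      rw [← trace_add, ← add_smul]; simp
    rw [this, ← ih, ← ih']
    rfl

end RunProperties

/-! ### From the diamond norm to the error on one basis state -/

section DiamondNorm

variable {ι : Type} [Fintype ι] [DecidableEq ι]

lemma traceNorm_nonneg (A : Matrix ι ι ℂ) : 0 ≤ traceNorm A :=
  Finset.sum_nonneg fun _ _ => Real.sqrt_nonneg _

lemma traceNorm_single (i : ι) : traceNorm (Matrix.single i i (1 : ℂ)) = 1 := by
  set A : Matrix ι ι ℂ := Matrix.single i i 1 with hA
  have hAA : Aᴴ * A = A := by simp [hA, Matrix.conjTranspose_single]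
  set h := isHermitian_conjTranspose_mul_self A
  have hidem : (Aᴴ * A) * (Aᴴ * A) = Aᴴ * A := by
    rw [hAA]; simp [hA]
  have hsq : ∀ j, √(h.eigenvalues j) = h.eigenvalues j := by
    intro j
    have h1 := h.mulVec_eigenvectorBasis j
    have h2 : (h.eigenvalues j * h.eigenvalues j) • (⇑(h.eigenvectorBasis j) : ι → ℂ)
        = h.eigenvalues j • (⇑(h.eigenvectorBasis j) : ι → ℂ) := by
      have := congrArg (fun B => B *ᵥ (⇑(h.eigenvectorBasis j) : ι → ℂ)) hidem
      simpa only [← mulVec_mulVec, h1, mulVec_smul, smul_smul] using this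
    have h3 : h.eigenvalues j * h.eigenvalues j = h.eigenvalues j := by
      by_contra hne
      have h4 : (h.eigenvalues j * h.eigenvalues j - h.eigenvalues j) •
          (⇑(h.eigenvectorBasis j) : ι → ℂ) = 0 := by rw [sub_smul, h2, sub_self]
      have h5 := (smul_eq_zero.1 h4).resolve_left (sub_ne_zero.2 hne)
      have h6 := h.eigenvectorBasis.orthonormal.ne_zero j
      exact h6 (by ext l; exact congrFun h5 l)
    rcases mul_eq_zero.1 (show h.eigenvalues j * (h.eigenvalues j - 1) = 0 by linarith) with h4 | h4
    · rw [h4, Real.sqrt_zero]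
    · rw [sub_eq_zero.1 h4, Real.sqrt_one]
  have htr : A.trace = _ := (congrArg trace hAA).symm.trans h.trace_eq_sum_eigenvalues
  rw [traceNorm, Finset.sum_congr rfl fun j _ => hsq j]
  have h1 : A.trace = 1 := by simp [hA]
  rw [h1] at htr
  have := congrArg Complex.re htr
  simpa using this.symm

/-- The operator norm is at most the trace norm: each singular value is at most their sum. -/
lemma posSemidef_sq_traceNorm_sub (A : Matrix ι ι ℂ) :
    (((traceNorm A ^ 2 : ℝ) : ℂ) • (1 : Matrix ι ι ℂ) - Aᴴ * A).PosSemidef := by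
  set h := isHermitian_conjTranspose_mul_self A
  set V : Matrix ι ι ℂ := h.eigenvectorUnitary.1
  have hVV : V * Vᴴ = 1 := Unitary.coe_mul_star_self h.eigenvectorUnitary
  have hspec : Aᴴ * A = V * diagonal (fun j => (h.eigenvalues j : ℂ)) * Vᴴ := by
    conv_lhs => rw [h.spectral_theorem]
    rw [Unitary.conjStarAlgAut_apply]
    rfl
  have hle : ∀ j, h.eigenvalues j ≤ traceNorm A ^ 2 := by
    intro j
    have h0 : 0 ≤ h.eigenvalues j := (posSemidef_conjTranspose_mul_self A).eigenvalues_nonneg j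
    rw [← Real.sq_sqrt h0]
    refine pow_le_pow_left₀ (Real.sqrt_nonneg _) ?_ 2
    exact Finset.single_le_sum (f := fun j => √(h.eigenvalues j))
      (fun _ _ => Real.sqrt_nonneg _) (Finset.mem_univ j)
  have h1 : ((traceNorm A ^ 2 : ℝ) : ℂ) • (1 : Matrix ι ι ℂ) - Aᴴ * A
      = V * diagonal (fun j => ((traceNorm A ^ 2 - h.eigenvalues j : ℝ) : ℂ)) * Vᴴ := by
    have : (diagonal (fun j => ((traceNorm A ^ 2 - h.eigenvalues j : ℝ) : ℂ)) : Matrix ι ι ℂ)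
        = ((traceNorm A ^ 2 : ℝ) : ℂ) • (1 : Matrix ι ι ℂ)
          - diagonal (fun j => (h.eigenvalues j : ℂ)) := by
      ext i j
      by_cases hij : i = j
      · subst hij; simp
      · simp [hij]
    rw [this, mul_sub, sub_mul, ← hspec, Matrix.mul_smul, Matrix.smul_mul, Matrix.mul_one, hVV]
  rw [h1]
  refine (PosSemidef.diagonal fun j => ?_).mul_mul_conjTranspose_same V
  exact Complex.zero_le_real.2 (sub_nonneg.2 (hle j))

lemma re_dotProduct_le_traceNorm (A : Matrix ι ι ℂ) {w : ι → ℂ} (hw : star w ⬝ᵥ w = 1) :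
    (star w ⬝ᵥ (A *ᵥ w)).re ≤ traceNorm A := by
  set c := traceNorm A
  have hc : 0 ≤ c := traceNorm_nonneg A
  have h1 : (star (A *ᵥ w) ⬝ᵥ (A *ᵥ w)).re ≤ c ^ 2 := by
    have := (Complex.le_def.1 ((posSemidef_sq_traceNorm_sub A).dotProduct_mulVec_nonneg w)).1
    rw [sub_mulVec, smul_mulVec, one_mulVec, dotProduct_sub, dotProduct_smul, hw,
      ← mulVec_mulVec, dotProduct_mulVec, ← star_mulVec] at this
    simp only [smul_eq_mul, mul_one, Complex.sub_re, Complex.ofReal_re, Complex.zero_re] at this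
    linarith
  -- This expands `‖d w - A w‖² ≥ 0`, a form of Cauchy–Schwarz. It is used with `d = c` if `c ≠ 0`,
  -- and with `d` equal to the real part itself if `c = 0`.
  have h2 : ∀ d : ℝ, 0 ≤ d ^ 2 - 2 * d * (star w ⬝ᵥ (A *ᵥ w)).re
      + (star (A *ᵥ w) ⬝ᵥ (A *ᵥ w)).re := by
    intro d
    have h := (Complex.le_def.1 (dotProduct_star_self_nonneg ((d : ℂ) • w - A *ᵥ w))).1
    have h3 : star (A *ᵥ w) ⬝ᵥ w = star (star w ⬝ᵥ (A *ᵥ w)) := by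
      rw [star_dotProduct]
    rw [star_sub, star_smul, sub_dotProduct, dotProduct_sub, dotProduct_sub,
      smul_dotProduct, smul_dotProduct, dotProduct_smul, dotProduct_smul, hw, h3] at h
    simp at h
    nlinarith
  by_cases hc0 : c = 0
  · by_contra hlt
    push Not at hlt
    rw [hc0] at hlt h1
    have := h2 ((star w ⬝ᵥ (A *ᵥ w)).re)
    nlinarith
  · have := h2 c
    have hpos : 0 < c := lt_of_le_of_ne hc (Ne.symm hc0)
    nlinarith

/-- Only the trivial ancilla `k = 1` and basis states as inputs are needed from the diamond norm. -/
lemma re_dotProduct_le_of_diamondNorm {Φ : Op₁ →ₗ[ℂ] Op₁} {ε : ℝ} (hε : 0 ≤ ε)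
    (h : diamondNorm Φ ≤ ENNReal.ofReal ε) (a : Fin 2) {w : Fin 2 → ℂ} (hw : star w ⬝ᵥ w = 1) :
    (star w ⬝ᵥ (Φ (Matrix.single a a 1) *ᵥ w)).re ≤ ε := by
  set A : Matrix (Fin 2 × Fin 1) (Fin 2 × Fin 1) ℂ := Matrix.single (a, 0) (a, 0) 1 with hA
  have h1 : ENNReal.ofReal (traceNorm (tensorId Φ 1 A)) ≤ ENNReal.ofReal ε := by
    refine le_trans ?_ h
    exact le_iSup_of_le 1 (le_iSup_of_le A (le_iSup_of_le (traceNorm_single _).le le_rfl))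
  rw [ENNReal.ofReal_le_ofReal_iff hε] at h1
  refine le_trans ?_ h1
  have h2 : ∀ i j : Fin 1, (of fun b c => A (b, i) (c, j)) = (Matrix.single a a 1 : Op₁) := by
    intro i j
    obtain rfl := Subsingleton.elim i 0
    obtain rfl := Subsingleton.elim j 0
    ext b c
    simp [hA, Matrix.single_apply]
  have h3 := re_dotProduct_le_traceNorm (tensorId Φ 1 A) (w := fun z => w z.1) (by
    rw [← hw]; simp [dotProduct, Fintype.sum_prod_type])
  refine le_trans (le_of_eq ?_) h3
  simp [dotProduct, mulVec, Fintype.sum_prod_type, tensorId, h2]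

end DiamondNorm

/-! ### Error caused by output probabilities with the wrong ratio -/

section ErrorBound

/-- Divide `(P² - Q²)² = (P - Q)² (P + Q)²` by `(P + Q)² ≤ 2 (P² + Q²) ≤ 4m`. -/
lemma sq_sub_ge_of_ratio {P Q m : ℝ} (hm : 0 ≤ m) (hPQ : P ^ 2 + Q ^ 2 ≤ 2 * m)
    {g : ℝ} (hg : 0 ≤ g) (h : g * m ≤ P ^ 2 - Q ^ 2) : g ^ 2 / 4 * m ≤ (P - Q) ^ 2 := by
  have h1 : (g * m) ^ 2 ≤ (P ^ 2 - Q ^ 2) ^ 2 := pow_le_pow_left₀ (by positivity) h 2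
  have h2 : (P ^ 2 - Q ^ 2) ^ 2 ≤ (P - Q) ^ 2 * (4 * m) := by
    have h3 : (P + Q) ^ 2 ≤ 4 * m := by nlinarith [sq_nonneg (P - Q)]
    calc (P ^ 2 - Q ^ 2) ^ 2 = (P - Q) ^ 2 * (P + Q) ^ 2 := by ring
      _ ≤ _ := mul_le_mul_of_nonneg_left h3 (sq_nonneg _)
  rcases hm.eq_or_lt with rfl | hm
  · rw [mul_zero]; exact sq_nonneg _
  · refine le_of_mul_le_mul_right (a := 4 * m) ?_ (by positivity)
    calc g ^ 2 / 4 * m * (4 * m) = (g * m) ^ 2 := by ring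
      _ ≤ _ := h1.trans h2

/-- Probability distributions on two outcomes whose ratio is far from that of `(s, 1 - s)` have a
large distance from it. -/
lemma error_lower_bound {δ s x₀ x₁ K : ℝ} (hδ : 0 < δ) (hδ' : δ < 1 / 16) (hs : 2 * δ ≤ s)
    (hs' : s ≤ 6 * δ) (h0 : 0 ≤ x₀) (h1 : 0 ≤ x₁)
    (h : x₀ = 0 ∨ x₁ = 0 ∨ x₀ = x₁ ∨ (64 ≤ K ∧ 8 * (K * δ) ^ 2 < 1 ∧ 4 * x₁ ≤ K * x₀)) :
    2 * δ ^ 2 * (x₀ + x₁) ≤ (√(x₀ * (1 - s)) - √(x₁ * s)) ^ 2 := by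
  have hs0 : 0 ≤ s := by linarith
  have hs1 : 0 ≤ 1 - s := by linarith
  have hP : √(x₀ * (1 - s)) ^ 2 = x₀ * (1 - s) := Real.sq_sqrt (by positivity)
  have hQ : √(x₁ * s) ^ 2 = x₁ * s := Real.sq_sqrt (by positivity)
  rcases h with rfl | rfl | rfl | ⟨hK, hKδ, hx⟩
  -- Here `x₀` belongs to the outcome of small target probability `s`. If it never occurs, the error
  -- is `s x₁`, and the lower bound on `s` is used.
  · rw [zero_mul, Real.sqrt_zero, zero_sub, neg_sq, hQ]
    have : 2 * δ ^ 2 ≤ s := by nlinarith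
    nlinarith
  · rw [zero_mul, Real.sqrt_zero, sub_zero, hP]
    have : 2 * δ ^ 2 ≤ 1 - s := by nlinarith
    nlinarith
  · have := sq_sub_ge_of_ratio (P := √(x₀ * (1 - s))) (Q := √(x₀ * s)) h0 (by
      rw [hP, hQ]; linarith) (g := 1 / 4) (by norm_num) (by rw [hP, hQ]; nlinarith)
    refine le_trans ?_ this
    have : 4 * δ ^ 2 ≤ (1 / 4) ^ 2 / 4 := by nlinarith
    nlinarith
  -- Since `8 (K δ)² < 1`, one has `x₀ ≥ 4 x₁ / K ≥ 8 √2 δ x₁ > 11 δ x₁` for `x₁ > 0`, well above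
  -- the target `s x₁ ≤ 6 δ x₁`. The bound `K ≥ 64` forces `δ` below `1 / 180`, which leaves ample
  -- room for the remaining constants.
  · have hδ2 : δ ≤ 1 / 180 := by
      by_contra hlt
      push Not at hlt
      have : 64 * (1 / 180) ≤ K * δ := mul_le_mul hK hlt.le (by norm_num) (by linarith)
      nlinarith
    have hKδ2 : 11 / 4 * (K * δ) ≤ 1 := by nlinarith
    have hx1 : 11 * (δ * x₁) ≤ x₀ := by
      calc 11 * (δ * x₁) = 11 / 4 * δ * (4 * x₁) := by ring
        _ ≤ 11 / 4 * δ * (K * x₀) := mul_le_mul_of_nonneg_left hx (by positivity)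
        _ = 11 / 4 * (K * δ) * x₀ := by ring
        _ ≤ 1 * x₀ := mul_le_mul_of_nonneg_right hKδ2 h0
        _ = x₀ := one_mul _
    have hQ' : x₁ * s ≤ 6 / 11 * x₀ := by
      calc x₁ * s ≤ x₁ * (6 * δ) := mul_le_mul_of_nonneg_left hs' h1
        _ = 6 / 11 * (11 * (δ * x₁)) := by ring
        _ ≤ _ := mul_le_mul_of_nonneg_left hx1 (by norm_num)
    have hs30 : s ≤ 1 / 30 := by linarith
    have hxs : x₀ * s ≤ x₀ * (1 / 30) := mul_le_mul_of_nonneg_left hs30 h0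
    have hxs0 : 0 ≤ x₀ * s := by positivity
    have := sq_sub_ge_of_ratio (P := √(x₀ * (1 - s))) (Q := √(x₁ * s)) h0 (by
      rw [hP, hQ]; linarith) (g := 2 / 5) (by norm_num) (by rw [hP, hQ]; linarith)
    refine le_trans ?_ this
    have h3 : δ ^ 2 * x₀ ≤ 1 / 180 * (1 / 180) * x₀ := by
      refine mul_le_mul_of_nonneg_right ?_ h0
      rw [sq]; exact mul_le_mul hδ2 hδ2 hδ.le (by norm_num)
    have h4 : δ ^ 2 * x₁ ≤ 1 / 180 * (x₀ / 11) := by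
      calc δ ^ 2 * x₁ = δ * (δ * x₁) := by ring
        _ ≤ 1 / 180 * (x₀ / 11) := mul_le_mul hδ2 (by linarith) (by positivity) (by norm_num)
    linarith

/-- Nothing is known about the off-diagonal entry except `|R 0 1|² ≤ R 0 0 * R 1 1`, from the
determinant. The left side is the value for the least favourable modulus and phase, so diagonal
entries alone control the error. -/
lemma posSemidef_fin_two_bound {R : Op₁} (hR : R.PosSemidef) (w : Fin 2 → ℂ) :
    (√((R 0 0).re * ‖w 0‖ ^ 2) - √((R 1 1).re * ‖w 1‖ ^ 2)) ^ 2 ≤ (star w ⬝ᵥ (R *ᵥ w)).re := by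
  have h0 := (Complex.le_def.1 (hR.diag_nonneg (i := 0)))
  have h1 := (Complex.le_def.1 (hR.diag_nonneg (i := 1)))
  simp only [Complex.zero_re, Complex.zero_im] at h0 h1
  have h00 : R 0 0 = ((R 0 0).re : ℂ) := by apply Complex.ext <;> simp [← h0.2]
  have h11 : R 1 1 = ((R 1 1).re : ℂ) := by apply Complex.ext <;> simp [← h1.2]
  have h10 : R 1 0 = star (R 0 1) := (hR.isHermitian.apply 1 0).symm
  have hdet := (Complex.le_def.1 hR.det_nonneg).1
  rw [det_fin_two, h10, h00, h11] at hdet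
  set a := (R 0 0).re
  set d := (R 1 1).re
  set z := R 0 1
  have hzz : z * star z = ((‖z‖ ^ 2 : ℝ) : ℂ) := by
    rw [RCLike.star_def, Complex.mul_conj, Complex.normSq_eq_norm_sq]
  rw [hzz, ← Complex.ofReal_mul, ← Complex.ofReal_sub] at hdet
  simp only [Complex.zero_re, Complex.ofReal_re] at hdet
  have hz : ‖z‖ ≤ √(a * d) := Real.le_sqrt_of_sq_le (by linarith)
  have hval : (star w ⬝ᵥ (R *ᵥ w)).re = a * ‖w 0‖ ^ 2 + d * ‖w 1‖ ^ 2
      + 2 * (star (w 0) * z * w 1).re := by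
    have e : star w ⬝ᵥ (R *ᵥ w) = (a : ℂ) * (star (w 0) * w 0) + (d : ℂ) * (star (w 1) * w 1)
        + (star (w 0) * z * w 1 + star (star (w 0) * z * w 1)) := by
      simp only [dotProduct, mulVec, Fin.sum_univ_two, Pi.star_apply, h10, star_mul', star_star]
      rw [h00, h11]
      ring
    have hww : ∀ v : ℂ, star v * v = ((‖v‖ ^ 2 : ℝ) : ℂ) := by
      intro v
      rw [RCLike.star_def, mul_comm, Complex.mul_conj, Complex.normSq_eq_norm_sq]
    rw [e, hww, hww, RCLike.star_def (K := ℂ), Complex.add_conj]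
    simp only [← Complex.ofReal_mul, ← Complex.ofReal_add, Complex.ofReal_re]
  have hcross : -(√(a * d) * (‖w 0‖ * ‖w 1‖)) ≤ (star (w 0) * z * w 1).re := by
    have h2 := (abs_le.1 (Complex.abs_re_le_norm (star (w 0) * z * w 1))).1
    rw [norm_mul, norm_mul, norm_star] at h2
    have : ‖w 0‖ * ‖z‖ * ‖w 1‖ ≤ √(a * d) * (‖w 0‖ * ‖w 1‖) := by
      calc ‖w 0‖ * ‖z‖ * ‖w 1‖ = ‖z‖ * (‖w 0‖ * ‖w 1‖) := by ring
        _ ≤ _ := mul_le_mul_of_nonneg_right hz (by positivity)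
    linarith
  rw [hval, Real.sqrt_mul h0.1, Real.sqrt_mul h1.1, Real.sqrt_sq (norm_nonneg _),
    Real.sqrt_sq (norm_nonneg _)]
  rw [Real.sqrt_mul h0.1] at hcross
  have e0 := Real.sq_sqrt h0.1
  have e1 := Real.sq_sqrt h1.1
  calc (√a * ‖w 0‖ - √d * ‖w 1‖) ^ 2 = √a ^ 2 * ‖w 0‖ ^ 2 + √d ^ 2 * ‖w 1‖ ^ 2
        - 2 * (√a * √d * (‖w 0‖ * ‖w 1‖)) := by ring
    _ ≤ _ := by rw [e0, e1]; linarith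

/-- The vector orthogonal to the column `a` of a one-qubit operator. -/
def columnOrthogonal (U : Op₁) (a : Fin 2) : Fin 2 → ℂ := ![-star (U 1 a), star (U 0 a)]

lemma norm_sq_column {U : Op₁} (hU : U ∈ Matrix.unitaryGroup (Fin 2) ℂ) (a : Fin 2) :
    ‖U 0 a‖ ^ 2 + ‖U 1 a‖ ^ 2 = 1 := by
  have h := congrFun (congrFun (Matrix.mem_unitaryGroup_iff'.1 hU) a) a
  rw [star_eq_conjTranspose, mul_apply, Fin.sum_univ_two, one_apply_eq, conjTranspose_apply,
    conjTranspose_apply, RCLike.star_def, Complex.conj_mul', Complex.conj_mul'] at h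
  exact_mod_cast h

lemma norm_sq_row {U : Op₁} (hU : U ∈ Matrix.unitaryGroup (Fin 2) ℂ) (a : Fin 2) :
    ‖U a 0‖ ^ 2 + ‖U a 1‖ ^ 2 = 1 := by
  have h := congrFun (congrFun (Matrix.mem_unitaryGroup_iff.1 hU) a) a
  rw [star_eq_conjTranspose, mul_apply, Fin.sum_univ_two, one_apply_eq, conjTranspose_apply,
    conjTranspose_apply, RCLike.star_def, Complex.mul_conj', Complex.mul_conj'] at h
  exact_mod_cast h

lemma columnOrthogonal_unit {U : Op₁} (hU : U ∈ Matrix.unitaryGroup (Fin 2) ℂ) (a : Fin 2) :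
    star (columnOrthogonal U a) ⬝ᵥ columnOrthogonal U a = 1 := by
  have h : ((‖U 0 a‖ : ℂ)) ^ 2 + (‖U 1 a‖ : ℂ) ^ 2 = 1 := by exact_mod_cast norm_sq_column hU a
  simp only [dotProduct, Fin.sum_univ_two, Pi.star_apply, columnOrthogonal, cons_val_zero,
    cons_val_one, star_neg, star_star, neg_mul_neg]
  rw [RCLike.star_def, Complex.mul_conj', Complex.mul_conj', add_comm, h]

lemma columnOrthogonal_dotProduct (U : Op₁) (a : Fin 2) :
    star (columnOrthogonal U a) ⬝ᵥ ((unitaryChannel U (Matrix.single a a 1)) *ᵥ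
      columnOrthogonal U a) = 0 := by
  have : unitaryChannel U (Matrix.single a a 1) = of fun i j => U i a * star (U j a) := by
    ext i j
    change (U * (Matrix.single a a 1 : Op₁) * Uᴴ : Op₁) i j = _
    rw [mul_apply, Finset.sum_eq_single a]
    · simp
    · intro b _ hb
      rw [Matrix.mul_single_apply_of_ne _ _ _ _ _ hb, zero_mul]
    · simp
  rw [this]
  simp only [dotProduct, mulVec, Fin.sum_univ_two, Pi.star_apply, columnOrthogonal, cons_val_zero,
    cons_val_one, star_neg, star_star, of_apply]
  ring

end ErrorBound

/-! ### Probability of violating runs and the lower bound -/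

section MainBound

lemma singleRegister_posSemidef {ρ : Op₁} (hρ : ρ.PosSemidef) : (singleRegister ρ).PosSemidef :=
  hρ.submatrix fun x : Fin 1 → Fin 2 => x 0

lemma trace_singleRegister (ρ : Op₁) : (singleRegister ρ).trace = ρ.trace :=
  Equiv.sum_comp (Equiv.funUnique (Fin 1) (Fin 2)) fun i => ρ i i

lemma single_posSemidef (a : Fin 2) : (Matrix.single a a 1 : Op₁).PosSemidef := by
  refine IsHermitian.posSemidef_of_mul_self ?_ (by simp)
  rw [IsHermitian, conjTranspose_single, star_one]

/-- For trace one, `1 - ρ` is the spin flip `Y ρᵀ Y` of `ρ`. -/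
lemma IsDensity.one_sub_posSemidef {ρ : Op₁} (hρ : IsDensity ρ) : (1 - ρ).PosSemidef := by
  have h := hρ.1.transpose.mul_mul_conjTranspose_same Pauli.Y.toMatrix
  have ht := hρ.2
  rw [trace_fin_two] at ht
  have e : 1 - ρ = Pauli.Y.toMatrix * ρᵀ * Pauli.Y.toMatrixᴴ := by
    rw [(Pauli.toMatrix_isHermitian .Y).eq]
    ext i j
    fin_cases i <;> fin_cases j <;>
      simp [Pauli.toMatrix, mul_apply, vecMul, dotProduct, Fin.sum_univ_two]
    · linear_combination -ht + ρ 1 1 * Complex.I_sq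
    · linear_combination -ρ 0 1 * Complex.I_sq
    · linear_combination -ρ 1 0 * Complex.I_sq
    · linear_combination -ht + ρ 0 0 * Complex.I_sq
  rw [e]
  exact h

variable {π : Protocol 1} {r : Run 1}

lemma prob_nonneg (hr : r ∈ π.runs) (a b : Fin 2) : 0 ≤ r.prob a b :=
  (Complex.le_def.1 ((π.map_posSemidef r hr _
    (singleRegister_posSemidef (single_posSemidef a))).diag_nonneg (i := b))).1

lemma trace_le_sum_prob (hr : r ∈ π.runs) {ρ : Op₁} (hρ : IsDensity ρ) :
    (r.map (singleRegister ρ)).trace.re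
      ≤ (r.prob 0 0 + r.prob 0 1) + (r.prob 1 0 + r.prob 1 1) := by
  have h := (Complex.le_def.1 (π.map_posSemidef r hr _
    (singleRegister_posSemidef hρ.one_sub_posSemidef)).trace_nonneg).1
  have h1 : (1 : Op₁) = Matrix.single 0 0 1 + Matrix.single 1 1 1 := by
    ext i j; fin_cases i <;> fin_cases j <;> simp
  rw [h1, map_sub, map_add, map_sub, map_add, trace_sub, trace_add, trace_fin_two, trace_fin_two]
    at h
  simp only [Complex.sub_re, Complex.add_re, Complex.zero_re] at h
  simp only [Run.prob]
  linarith

lemma sum_error (w : Fin 2 → ℂ) (A : Op₁) (l : List (Run 1)) :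
    (star w ⬝ᵥ ((l.map fun r => r.map ∘ₗ singleRegister).sum A *ᵥ w)).re
      = (l.map fun r => (star w ⬝ᵥ (r.map (singleRegister A) *ᵥ w)).re).sum := by
  induction l with
  | nil => simp
  | cons r l ih =>
    simp only [List.map_cons, List.sum_cons, ← ih, LinearMap.add_apply, add_mulVec,
      dotProduct_add, Complex.add_re, LinearMap.comp_apply]

/-- If a protocol approximates a unitary, then its runs output the wrong state with small total
probability. -/
lemma sum_error_le {U : Op₁} (hU : U ∈ Matrix.unitaryGroup (Fin 2) ℂ) {ε : ℝ} (hε : 0 ≤ ε)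
    (h : π.Approximates U ε) (a : Fin 2) :
    (π.runs.map fun r => (star (columnOrthogonal U a) ⬝ᵥ
      (r.map (singleRegister (Matrix.single a a 1)) *ᵥ columnOrthogonal U a)).re).sum ≤ ε := by
  have h1 := re_dotProduct_le_of_diamondNorm hε h a (columnOrthogonal_unit hU a)
  rw [LinearMap.sub_apply, sub_mulVec, dotProduct_sub, columnOrthogonal_dotProduct, sub_zero,
    Protocol.channel, sum_error] at h1
  exact h1

/-- The lower bound on the resources consumed by a run. -/
def Run.SatisfiesBound (C ε : ℝ) (r : Run 1) : Prop :=
  (1 / 14) * Real.logb 2 (1 / ε) - (1 / 14) * Real.logb 2 C - 3 / 14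
    ≤ (r.numRootT : ℝ) + (6 / 7) * (r.numT : ℝ)

/-- With `K = 2 ^ (6 M + 7 N)`, the logarithm of `8 K² C` is `3 + 14 (N + 6 M / 7) + log₂ C`; this
explains the constants `1/14`, `6/7` and `3/14`. -/
lemma Run.lt_of_not_satisfiesBound {C ε : ℝ} (hC : 0 < C) (hε : 0 < ε)
    (h : ¬r.SatisfiesBound C ε) : 8 * (64 ^ r.numT * 128 ^ r.numRootT) ^ 2 * (C * ε) < 1 := by
  rw [Run.SatisfiesBound, not_le] at h
  have hlog : Real.logb 2 (8 * (64 ^ r.numT * 128 ^ r.numRootT) ^ 2 * C)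
      = 3 + 2 * (6 * r.numT + 7 * r.numRootT) + Real.logb 2 C := by
    have h2 : Real.logb 2 2 = 1 := Real.logb_self_eq_one (by norm_num)
    rw [show (8 : ℝ) = 2 ^ 3 by norm_num, show (64 : ℝ) = 2 ^ 6 by norm_num,
      show (128 : ℝ) = 2 ^ 7 by norm_num, Real.logb_mul (by positivity) hC.ne',
      Real.logb_mul (by positivity) (by positivity), Real.logb_pow, Real.logb_pow,
      Real.logb_mul (by positivity) (by positivity)]
    simp only [Real.logb_pow, h2]
    push_cast
    ring
  have h1 : 8 * (64 ^ r.numT * 128 ^ r.numRootT) ^ 2 * C < 1 / ε := by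
    rw [← Real.logb_lt_logb_iff (b := 2) (by norm_num) (by positivity) (by positivity), hlog]
    linarith
  rw [lt_div_iff₀ hε] at h1
  linarith

lemma Run.error_of_not_satisfiesBound {C ε : ℝ} (hC : 1 < C) (hε : 0 < ε)
    (hεC : ε < 1 / (2 ^ 8 * C)) {U : Op₁} (hU : U ∈ Matrix.unitaryGroup (Fin 2) ℂ)
    (hs : 2 * √(C * ε) ≤ ‖U 0 1‖ ^ 2) (hs' : ‖U 0 1‖ ^ 2 ≤ 6 * √(C * ε)) (hr : r ∈ π.runs)
    (h : ¬r.SatisfiesBound C ε) (a : Fin 2) :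
    2 * (C * ε) * (r.prob a 0 + r.prob a 1) ≤ (star (columnOrthogonal U a) ⬝ᵥ
      (r.map (singleRegister (Matrix.single a a 1)) *ᵥ columnOrthogonal U a)).re := by
  have hC0 : 0 < C := by linarith
  have hCε : 0 < C * ε := by positivity
  have hδ := Real.sqrt_pos.2 hCε
  have hδ2 : √(C * ε) ^ 2 = C * ε := Real.sq_sqrt hCε.le
  have hδ' : √(C * ε) < 1 / 16 := by
    rw [Real.sqrt_lt' (by norm_num)]
    rw [lt_div_iff₀ (by positivity)] at hεC
    linarith
  have hK := Run.lt_of_not_satisfiesBound hC0 hε h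
  -- Here `b` is the outcome that `U` makes unlikely: `1` on input `0`, and `0` on input `1`. Both
  -- choices are needed below.
  have key : ∀ b c : Fin 2, 2 * (C * ε) * (r.prob a b + r.prob a c) ≤
      (√(r.prob a b * (1 - ‖U 0 1‖ ^ 2)) - √(r.prob a c * ‖U 0 1‖ ^ 2)) ^ 2 := by
    intro b c
    rw [← hδ2]
    refine error_lower_bound (K := 64 ^ r.numT * 128 ^ r.numRootT) hδ hδ' hs hs'
      (prob_nonneg hr a b) (prob_nonneg hr a c) ?_
    by_cases hb : r.prob a b = 0
    · exact .inl hb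
    by_cases hc : r.prob a c = 0
    · exact .inr (.inl hc)
    obtain ⟨h1, h2⟩ := Protocol.prob_ratio hr a hb hc
    by_cases h0 : r.numT + r.numRootT = 0
    · exact .inr (.inr (.inl (h1 (by omega) (by omega))))
    · refine .inr (.inr (.inr ⟨?_, by rw [mul_pow, hδ2]; linarith, h2 h0⟩))
      by_cases hT : r.numT = 0
      · calc (64 : ℝ) ≤ 1 * 128 ^ 1 := by norm_num
          _ ≤ 64 ^ r.numT * 128 ^ r.numRootT :=
            mul_le_mul (one_le_pow₀ (by norm_num))
              (pow_le_pow_right₀ (by norm_num) (by omega)) (by positivity) (by positivity)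
      · calc (64 : ℝ) = 64 ^ 1 * 1 := by norm_num
          _ ≤ 64 ^ r.numT * 128 ^ r.numRootT :=
            mul_le_mul (pow_le_pow_right₀ (by norm_num) (by omega))
              (one_le_pow₀ (by norm_num)) (by positivity) (by positivity)
  have hpsd := posSemidef_fin_two_bound (π.map_posSemidef r hr _
    (singleRegister_posSemidef (single_posSemidef a))) (columnOrthogonal U a)
  refine le_trans ?_ hpsd
  have e0 : ‖columnOrthogonal U a 0‖ = ‖U 1 a‖ := by simp [columnOrthogonal]
  have e1 : ‖columnOrthogonal U a 1‖ = ‖U 0 a‖ := by simp [columnOrthogonal]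
  rw [e0, e1]
  change _ ≤ (√(r.prob a 0 * _) - √(r.prob a 1 * _)) ^ 2
  have hc0 := norm_sq_column hU 0
  have hc1 := norm_sq_column hU 1
  have hr0 := norm_sq_row hU 0
  fin_cases a
  · have h1 : ‖U 1 0‖ ^ 2 = ‖U 0 1‖ ^ 2 := by linarith
    have h2 : ‖U 0 0‖ ^ 2 = 1 - ‖U 0 1‖ ^ 2 := by linarith
    simp only [Fin.zero_eta, h1, h2] at key ⊢
    have := key 1 0
    rw [sub_sq_comm, add_comm]
    exact this
  · have h1 : ‖U 1 1‖ ^ 2 = 1 - ‖U 0 1‖ ^ 2 := by linarith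
    simp only [Fin.mk_one, h1] at key ⊢
    exact key 0 1

theorem resourceLowerBound_of_norm_sq {C ε : ℝ} (hC : 1 < C) (hε : 0 < ε)
    (hεC : ε < 1 / (2 ^ 8 * C)) {U : Op₁} (hU : U ∈ Matrix.unitaryGroup (Fin 2) ℂ)
    (hs : 2 * √(C * ε) ≤ ‖U 0 1‖ ^ 2) (hs' : ‖U 0 1‖ ^ 2 ≤ 6 * √(C * ε)) :
    ResourceLowerBound C ε U := by
  classical
  intro π hπ ρ hρ
  have hC0 : 0 < C := by linarith
  change _ ≤ π.probability (Run.SatisfiesBound C ε) ρ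
  -- Each violating run wastes at least the fraction `2Cε` of its probability, and the total error
  -- is at most `ε`. The extra factor `2` pays for adding up the two basis states afterwards.
  have hbad : ∀ a : Fin 2, C * (π.runs.map fun r =>
      if r.SatisfiesBound C ε then 0 else r.prob a 0 + r.prob a 1).sum ≤ 1 / 2 := by
    intro a
    have h1 : 2 * (C * ε) * (π.runs.map fun r =>
        if r.SatisfiesBound C ε then 0 else r.prob a 0 + r.prob a 1).sum ≤ ε := by
      rw [← List.sum_map_mul_left]
      refine le_trans (List.sum_le_sum fun r hr => ?_) (sum_error_le hU hε.le hπ a)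
      split_ifs with h
      · rw [mul_zero]
        exact (sq_nonneg _).trans (posSemidef_fin_two_bound (π.map_posSemidef r hr _
          (singleRegister_posSemidef (single_posSemidef a))) (columnOrthogonal U a))
      · exact Run.error_of_not_satisfiesBound hC hε hεC hU hs hs' hr h a
    refine le_of_mul_le_mul_left (a := 2 * ε) ?_ (by positivity)
    linarith
  have hbadρ : (π.runs.map fun r => if r.SatisfiesBound C ε then 0 else
      (r.map (singleRegister ρ)).trace.re).sum ≤
      (π.runs.map fun r => if r.SatisfiesBound C ε then 0 else r.prob 0 0 + r.prob 0 1).sum +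
      (π.runs.map fun r => if r.SatisfiesBound C ε then 0 else r.prob 1 0 + r.prob 1 1).sum := by
    rw [← List.sum_map_add]
    refine List.sum_le_sum fun r hr => ?_
    split_ifs
    · simp
    · exact trace_le_sum_prob hr hρ
  have htot : π.probability (Run.SatisfiesBound C ε) ρ + (π.runs.map fun r =>
      if r.SatisfiesBound C ε then 0 else (r.map (singleRegister ρ)).trace.re).sum = 1 := by
    have h1 := congrArg Complex.re (π.sum_trace (singleRegister ρ))
    rw [trace_singleRegister, hρ.2, Complex.one_re] at h1
    have h2 : ∀ l : List ℂ, l.sum.re = (l.map Complex.re).sum := fun l => by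
      induction l with
      | nil => simp
      | cons z l ih => simp [ih]
    rw [h2, List.map_map] at h1
    rw [Protocol.probability, ← List.sum_map_add, ← h1]
    congr 1
    refine List.map_congr_left fun r _ => ?_
    by_cases h : r.SatisfiesBound C ε <;> simp [h]
  rw [div_le_iff₀ hC0]
  have h0 := hbad 0
  have h1 := hbad 1
  nlinarith

/-- A real rotation with a given transition probability. -/
lemma exists_unitary_norm_sq {s : ℝ} (h0 : 0 ≤ s) (h1 : s ≤ 1) :
    ∃ U ∈ Matrix.unitaryGroup (Fin 2) ℂ, ‖U 0 1‖ ^ 2 = s := by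
  have e0 : (√s : ℂ) * √s = s := by rw [← Complex.ofReal_mul, Real.mul_self_sqrt h0]
  have e1 : (√(1 - s) : ℂ) * √(1 - s) = 1 - s := by
    rw [← Complex.ofReal_mul, Real.mul_self_sqrt (by linarith)]; simp
  refine ⟨!![(√(1 - s) : ℂ), √s; -√s, √(1 - s)], ?_, ?_⟩
  · rw [Matrix.mem_unitaryGroup_iff]
    ext i j
    fin_cases i <;> fin_cases j <;>
      simp [star_eq_conjTranspose, mul_apply, Fin.sum_univ_two, e0, e1, mul_comm]
  · simp [Complex.norm_real, Real.sq_sqrt h0]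

end MainBound

end StabSynth

end

theorem mainTheorem12 (C ε : ℝ) (hC : 1 < C) (hε : 0 < ε) (hεC : ε < 1 / (2 ^ 8 * C)) :
    (∃ U ∈ Matrix.unitaryGroup (Fin 2) ℂ, StabSynth.ResourceLowerBound C ε U) ∧
    (∀ U ∈ Matrix.unitaryGroup (Fin 2) ℂ,
      2 * Real.sqrt (C * ε) ≤ ‖U 0 1‖ ^ 2 → ‖U 0 1‖ ^ 2 ≤ 6 * Real.sqrt (C * ε) →
        StabSynth.ResourceLowerBound C ε U) := by
  refine ⟨?_, fun U hU hs hs' => StabSynth.resourceLowerBound_of_norm_sq hC hε hεC hU hs hs'⟩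
  have hδ := Real.sqrt_nonneg (C * ε)
  have hδ' : Real.sqrt (C * ε) < 1 / 16 := by
    rw [Real.sqrt_lt' (by norm_num)]
    rw [lt_div_iff₀ (by positivity)] at hεC
    linarith
  -- The lower end of the admissible interval is attained: it is below `1 / 8`, so a real rotation
  -- realizes it.
  obtain ⟨U, hU, h⟩ := StabSynth.exists_unitary_norm_sq (s := 2 * Real.sqrt (C * ε))
    (by positivity) (by linarith)
  exact ⟨U, hU, StabSynth.resourceLowerBound_of_norm_sq hC hε hεC hU h.ge (by linarith)⟩
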